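/- **Definitions.** A *square path* of size $N$ is a lattice path from $(0,0)$ to $(N,N)$ with unit north and east steps which, if not empty, ends with an east step. Its *shift* is the largest $s$ such that it meets the line $y=x-s$; its *area word* is $a_1,\dots,a_N$, where the $i$-th north step starts on the line $y=x+a_i$. A *partial labelling* is a word $w\in\mathbb N^N$ (with $0\in\mathbb N$) such that $w_i>w_{i-1}$ whenever $a_i>a_{i-1}$; $w_1>0$ if $a_1=0$; and (if $N>0$) $w_i>0$ for some $i$ with $a_i=-s$, where $s$ is the shift. A row $i$ is a *contractible valley* if either $i=1$ and ($a_1<-1$, or $a_1=-1$ and $w_1>0$), or $i>1$ and ($a_i<a_{i-1}$, or $a_i=a_{i-1}$ and $w_i>w_{i-1}$). Let $\mathrm{LSQ}(m,n)^{\bullet k}$ be the set of triples $\pi=(\text{path},w,dv)$ of a square path of size $m+n$, a partial labelling $w$ with $m$ zeros and $n$ positive labels, and a set $dv$ of $k$ contractible valleys (the decorated ones). For such $\pi$ of shift $s$ let $\mathrm{area}(\pi)=\sum_i(a_i+s)$, let $$\mathrm{dinv}(\pi)=\#\{i<j : (i,j)\text{ is an inversion},\ i\notin dv\}+\#\{i: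 a_i<0,\ w_i>0\}-\#dv,$$ where $(i,j)$ is an inversion if $a_i=a_j$ and $w_i<w_j$, or $a_i=a_j+1$ and $w_i>w_j$, and let $x^\pi=\prod_i x_{w_i}$ with $x_0=1$. The *diagonal word* $\mathrm{dw}(\pi)$ is $\rho_\ell\cdots\rho_1\rho_0$, where $\rho_i$ lists the labels of the north steps starting on $y=x+i-s$, those of decorated valleys marked with $\bullet$, in increasing order for $c<\overset{\bullet}{c}<c+1$, and $\ell$ is the largest $i$ with $\rho_i\neq\varnothing$. For a marked word $z$ write $z=\rho_\ell\cdots\rho_0$ for its decomposition into runs (maximal weakly increasing factors, disregarding the marks), with $\rho_i=\varnothing$ for $i<0$ or $i>\ell$. Let $\#\rho'_i$ be the number of unmarked positive letters of $\rho_i$ and $z_i^\bullet(0)$ the number of marked zeros in $\rho_i$. Put $[k]_q=\frac{1-q^k}{1-q}$. **Theorem.** Let $z$ be the diagonal word of some element of $\mathrm{LSQ}(m,n)^{\bullet k}$, and for $s\ge 0$ let $$\mathrm{LSQ}_{q,t;x}(z,s)=\sum_{\substack{\pi\in \mathrm{LSQ}(m,n)^{\bullet k}\\ \mathrm{shift}(\pi)=s,\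 \mathrm{dw}(\pi)=z}}q^{\mathrm{dinv}(\pi)}t^{\mathrm{area}(\pi)}x^\pi .$$ Let $s\ge1$. If $\#\rho'_{s-1}\ne z^\bullet_{s-2}(0)$, then $$\mathrm{LSQ}_{q,t;x}(z,s)=q^{\#\rho'_{s-1}-z^\bullet_{s-2}(0)}\,\frac{[\#\rho'_s-z^\bullet_{s-1}(0)]_q}{[\#\rho'_{s-1}-z^\bullet_{s-2}(0)]_q}\,\mathrm{LSQ}_{q,t;x}(z,s-1).$$ Moreover, without this condition the identity holds in the form with the denominator cleared: $$[\#\rho'_{s-1}-z^\bullet_{s-2}(0)]_q\,\mathrm{LSQ}_{q,t;x}(z,s)=q^{\#\rho'_{s-1}-z^\bullet_{s-2}(0)}\,[\#\rho'_s-z^\bullet_{s-1}(0)]_q\,\mathrm{LSQ}_{q,t;x}(z,s-1).$$ -/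

import Mathlib

/-- Unit steps of a lattice path. -/
inductive Step
  | north
  | east
  deriving DecidableEq

instance : Fintype Step := ⟨{Step.north, Step.east}, fun d => by cases d <;> simp⟩

/-- A square path of size `N`: a lattice path from `(0,0)` to `(N,N)` made of unit north and east
steps which (when it is not empty) ends with an east step. -/
structure SquarePath (N : ℕ) where
  steps : List Step
  count_north : steps.count Step.north = N
  count_east : steps.count Step.east = N
  ends_east : ∀ d ∈ steps.getLast?, d = Step.east

/-- The value of `y - x` at the endpoint of a lattice path starting at the origin. -/
def height (l : List Step) : ℤ := (l.count Step.north : ℤ) - (l.count Step.east : ℤ)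

/-- The values of `y - x` at the starting points of the north steps of a lattice path that starts
on the diagonal `y = x + h`, listed along the path. -/
def areaWordFrom : ℤ → List Step → List ℤ
  | _, [] => []
  | h, Step.north :: l => h :: areaWordFrom (h + 1) l
  | h, Step.east :: l => areaWordFrom (h - 1) l

theorem length_areaWordFrom (h : ℤ) (l : List Step) :
    (areaWordFrom h l).length = l.count Step.north := by
  induction l generalizing h with
  | nil => rfl
  | cons d l ih => cases d <;> simp [areaWordFrom, ih]

namespace SquarePath

variable {N : ℕ}

/-- The area word: the north step in row `i` (rows are numbered from `0`) starts on the diagonal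
`y = x + π.a i`. -/
def a (π : SquarePath N) (i : Fin N) : ℤ :=
  (areaWordFrom 0 π.steps)[(i : ℕ)]'(by
    rw [length_areaWordFrom, π.count_north]; exact i.isLt)

/-- The shift: the largest `s` such that the path meets the line `y = x - s` (the maximum is
attained at a lattice point of the path, and it is nonnegative since the path starts at the
origin). -/
def shift (π : SquarePath N) : ℕ :=
  (Finset.range (π.steps.length + 1)).sup fun j => (-height (π.steps.take j)).toNat

theorem neg_shift_le_a (π : SquarePath N) (i : Fin N) : -(π.shift : ℤ) ≤ π.a i := by
  have key : ∀ (l : List Step) (h x : ℤ), x ∈ areaWordFrom h l →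
      ∃ j ≤ l.length, x = h + height (l.take j) := by
    intro l
    induction l with
    | nil => intro h x hx; simp [areaWordFrom] at hx
    | cons d l ih =>
      intro h x hx
      cases d with
      | north =>
        rcases List.mem_cons.1 hx with rfl | hx
        · exact ⟨0, by simp, by simp [height]⟩
        · obtain ⟨j, hj, e⟩ := ih _ _ hx
          refine ⟨j + 1, by simpa using hj, ?_⟩
          rw [e]
          simp [height]
          ring
      | east =>
        obtain ⟨j, hj, e⟩ := ih _ _ hx
        refine ⟨j + 1, by simpa using hj, ?_⟩
        rw [e]
        simp [height]
        ring
  obtain ⟨j, hj, e⟩ := key π.steps 0 (π.a i) (List.getElem_mem _)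
  have h1 : (-height (π.steps.take j)).toNat ≤ π.shift :=
    Finset.le_sup (f := fun j => (-height (π.steps.take j)).toNat)
      (Finset.mem_range.2 (by omega))
  omega

end SquarePath

/-- A partially labelled square path of size `N`. -/
structure LabelledSquarePath (N : ℕ) extends SquarePath N where
  label : Fin N → ℕ
  label_lt : ∀ i j : Fin N, (j : ℕ) = i + 1 →
    toSquarePath.a i < toSquarePath.a j → label i < label j
  label_first : ∀ i : Fin N, (i : ℕ) = 0 → toSquarePath.a i = 0 → 0 < label i
  label_base : 0 < N → ∃ i : Fin N, toSquarePath.a i = -(toSquarePath.shift : ℤ) ∧ 0 < label i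

/-- Row `j` is a contractible valley. -/
def LabelledSquarePath.IsContractibleValley {N : ℕ} (π : LabelledSquarePath N) (j : Fin N) : Prop :=
  ((j : ℕ) = 0 ∧ (π.a j < -1 ∨ (π.a j = -1 ∧ 0 < π.label j))) ∨
  ∃ i : Fin N, (j : ℕ) = i + 1 ∧
    (π.a j < π.a i ∨ (π.a j = π.a i ∧ π.label i < π.label j))

/-- Valley-decorated partially labelled square paths of size `m + n` with `m` labels equal to `0`,
`n` positive labels and `k` decorated contractible valleys. -/
structure ValleyDecoratedPath (m n k : ℕ) extends LabelledSquarePath (m + n) where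
  dv : Finset (Fin (m + n))
  dv_valley : ∀ j ∈ dv, toLabelledSquarePath.IsContractibleValley j
  card_positive : (Finset.univ.filter fun i => 0 < label i).card = n
  card_dv : dv.card = k

/-- A letter of a marked word: a natural number, together with a flag that is `true` when the
letter is decorated. Letters are ordered lexicographically, so an undecorated `c` comes before a
decorated `c`, which comes before `c + 1`. -/
abbrev MarkedLetter : Type := ℕ ×ₗ Bool

/-- A marked word in the alphabet `ℕ`. -/
abbrev MarkedWord : Type := List MarkedLetter

namespace MarkedWord

/-- The run `ρ_i` of `z = ρ_ℓ ⋯ ρ_1 ρ_0`, where the runs are the maximal weakly increasing factors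
of `z`, disregarding decorations. It is empty for `i < 0` and for `i > ℓ`. -/
def run (z : MarkedWord) (i : ℤ) : MarkedWord :=
  if i < 0 then []
  else (z.splitBy fun x y => decide ((ofLex x).1 ≤ (ofLex y).1)).reverse.getD i.toNat []

/-- The number `z_i^•(c)` of decorated letters `c` in `ρ_i`. -/
def multDec (z : MarkedWord) (i : ℤ) (c : ℕ) : ℕ := (z.run i).count (toLex (c, true))

/-- The word `ρ'_i`: the run `ρ_i` with its decorated letters and its zeros deleted. -/
def runPos (z : MarkedWord) (i : ℤ) : MarkedWord :=
  (z.run i).filter fun x => (ofLex x).2 = false ∧ (ofLex x).1 ≠ 0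

end MarkedWord

noncomputable section

/-- The field `ℚ(q,t)`. -/
abbrev QT : Type := FractionRing (MvPolynomial (Fin 2) ℚ)

/-- The variable `q`. -/
def qVar : QT := algebraMap (MvPolynomial (Fin 2) ℚ) QT (MvPolynomial.X 0)

/-- The variable `t`. -/
def tVar : QT := algebraMap (MvPolynomial (Fin 2) ℚ) QT (MvPolynomial.X 1)

/-- The `q`-analogue `[k]_q = (1 - q^k) / (1 - q)`. -/
def qInt (k : ℤ) : QT := (1 - qVar ^ k) / (1 - qVar)

namespace ValleyDecoratedPath

variable {m n k : ℕ}

/-- The pair of rows `(i, j)` is a (primary or secondary) inversion. -/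
def IsInversion (π : ValleyDecoratedPath m n k) (i j : Fin (m + n)) : Prop :=
  i < j ∧ ((π.a i = π.a j ∧ π.label i < π.label j) ∨
    (π.a i = π.a j + 1 ∧ π.label j < π.label i))

open Classical in
/-- The dinv: the number of inversions `(i, j)` whose left row `i` is not a decorated valley, plus
the number of positive labels below the main diagonal, minus the number of decorations. -/
def dinv (π : ValleyDecoratedPath m n k) : ℤ :=
  ((Finset.univ.filter fun p : Fin (m + n) × Fin (m + n) =>
      π.IsInversion p.1 p.2 ∧ p.1 ∉ π.dv).card : ℤ)
    + ((Finset.univ.filter fun i : Fin (m + n) => π.a i < 0 ∧ 0 < π.label i).card : ℤ)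
    - (π.dv.card : ℤ)

/-- The area. -/
def area (π : ValleyDecoratedPath m n k) : ℤ := ∑ i, (π.a i + (π.shift : ℤ))

/-- The monomial `x^π`, with `x_0 = 1`. -/
def monomial (π : ValleyDecoratedPath m n k) : MvPolynomial ℕ QT :=
  ∏ i, if π.label i = 0 then 1 else MvPolynomial.X (π.label i)

/-- The marked letter in row `j`. -/
def letter (π : ValleyDecoratedPath m n k) (j : Fin (m + n)) : MarkedLetter :=
  toLex (π.label j, decide (j ∈ π.dv))

/-- The marked labels on the `i`-th diagonal `y = x + i - s`, in increasing order. -/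
def diagonal (π : ValleyDecoratedPath m n k) (i : ℕ) : MarkedWord :=
  ((Finset.univ.filter fun j => π.a j = (i : ℤ) - (π.shift : ℤ)).val.map π.letter).sort (· ≤ ·)

/-- The index `ℓ` of the highest diagonal that carries a label. -/
def top (π : ValleyDecoratedPath m n k) : ℕ :=
  Finset.univ.sup fun j => (π.a j + (π.shift : ℤ)).toNat

/-- The diagonal word `ρ_ℓ ⋯ ρ_1 ρ_0`. -/
def diagonalWord (π : ValleyDecoratedPath m n k) : MarkedWord :=
  (List.range (π.top + 1)).reverse.flatMap π.diagonal

theorem letter_mem_diagonalWord (π : ValleyDecoratedPath m n k) (j : Fin (m + n)) :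
    π.letter j ∈ π.diagonalWord := by
  have h0 : 0 ≤ π.a j + (π.shift : ℤ) := by
    have := π.toSquarePath.neg_shift_le_a j
    linarith
  have h1 : (π.a j + (π.shift : ℤ)).toNat ≤ π.top :=
    Finset.le_sup (f := fun j => (π.a j + (π.shift : ℤ)).toNat) (Finset.mem_univ j)
  simp only [diagonalWord, List.mem_flatMap, List.mem_reverse, List.mem_range]
  refine ⟨(π.a j + (π.shift : ℤ)).toNat, by omega, ?_⟩
  simp only [diagonal, Multiset.mem_sort, Multiset.mem_map, Finset.mem_val, Finset.mem_filter,
    Finset.mem_univ, true_and]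
  exact ⟨j, by omega, rfl⟩

/-- There are finitely many paths with a given diagonal word and a given shift. -/
theorem finite_setOf (m n k : ℕ) (z : MarkedWord) (s : ℕ) :
    {π : ValleyDecoratedPath m n k | π.shift = s ∧ π.diagonalWord = z}.Finite := by
  let f : ValleyDecoratedPath m n k → List Step × (Fin (m + n) → ℕ) × Finset (Fin (m + n)) :=
    fun π => (π.steps, π.label, π.dv)
  have hf : Function.Injective f := by
    rintro ⟨⟨⟨_, _, _, _⟩, _, _, _, _⟩, _, _, _, _⟩ ⟨⟨⟨_, _, _, _⟩, _, _, _, _⟩, _, _, _, _⟩ h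
    simp only [f, Prod.mk.injEq] at h
    obtain ⟨rfl, rfl, rfl⟩ := h
    rfl
  refine Set.Finite.of_finite_image (f := f) ?_ hf.injOn
  have hS : {l : List Step | l.length = (m + n) + (m + n)}.Finite := List.finite_length_eq _ _
  have hL : (Set.univ.pi fun _ : Fin (m + n) =>
      {c : ℕ | c ∈ z.map fun x => (ofLex x).1}).Finite :=
    Set.Finite.pi fun _ => List.finite_toSet _
  refine (hS.prod (hL.prod Set.finite_univ)).subset ?_
  rintro _ ⟨π, ⟨-, hz⟩, rfl⟩
  refine ⟨?_, ?_, Set.mem_univ _⟩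
  · have h : ∀ l : List Step, l.length = l.count Step.north + l.count Step.east := by
      intro l
      induction l with
      | nil => rfl
      | cons d l ih => cases d <;> simp [ih] <;> omega
    have := h π.steps
    rw [π.count_north, π.count_east] at this
    exact this
  · intro j _
    refine List.mem_map.2 ⟨π.letter j, ?_, rfl⟩
    rw [← hz]
    exact π.letter_mem_diagonalWord j

end ValleyDecoratedPath

/-- The enumerator `LSQ_{q,t;x}(z,s)`: the sum of `q^dinv t^area x^π` over the valley-decorated
partially labelled square paths `π` (with `m` zero labels, `n` positive labels and `k` decorations)
with diagonal word `z` and shift `s`. -/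
def LSQ (m n k : ℕ) (z : MarkedWord) (s : ℕ) : MvPolynomial ℕ QT :=
  ∑ π ∈ (ValleyDecoratedPath.finite_setOf m n k z s).toFinset,
    MvPolynomial.C (qVar ^ π.dinv * tVar ^ π.area) * π.monomial

end

/-! A path is read as a word of rows (level, label, decoration), where levels are counted from the
lowest diagonal. In the diagonal word the last letter of each `ρ_{b+1}` exceeds the first letter of
`ρ_b`, since the path must step up from level `b` to level `b + 1` and labels increase along such a
step. Hence the runs are the diagonals, and fixing `z` means fixing the multiset `M` of rows. Area,
`x^π` and the number of decorations depend only on `M`, so `LSQ m n k z s` is a constant times `q ^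
bonus s M * pathSum q s (startOrigin s) M`: a sum of `q ^ inversions` over the admissible orderings
of `M`. The shift enters only through the level `s` of the main diagonal, which governs the start,
the end and the bonus.

Path sums factor. If all copies of one row are inserted in a suitable order, the sum is multiplied
by a complete homogeneous polynomial in `1, q, …` (undecorated rows, `pathSum_insert_below` and
`pathSum_insert_above`) or, up to a power of `q`, by an elementary one (decorated rows,
`pathSum_insert_marked`, where equal rows cannot be adjacent). The number of variables is
essentially the number of places where the new row fits.

It remains to compare the factors for the shifts `s` and `s - 1`. Undecorated rows outside the
levels `s - 1` and `s` contribute equally (`exists_pathSum_eq_window`). On these two levels the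
products of complete polynomials telescope into `q`-factorials, and the ratio is that of the numbers
of positive labels (`two_level_identity`). Decorated rows, with their bonus, contribute equally
except for the zeros on the levels `s - 1` and `s - 2`, whose start condition changes. There `[w -
r] e_r(w) = [w] e_r(w - 1)` corrects each `q`-integer by the number of marked zeros. The power of
`q` comes from the positive labels on the level `s - 1`, which lie below the main diagonal only for
the shift `s`, and from the marked zeros on the level `s - 2`. These parts meet in `pathSum_ratio`.
-/

section QNumbers

/-! ### `q`-integers and symmetric polynomials in `1, q, …, q^(w-1)` -/

variable {K : Type*} [Field K] (q : K)

/-- The `q`-analogue `1 + q + ⋯ + q^(n-1)` of a natural number. -/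
def qNat (n : ℕ) : K := ∑ i ∈ Finset.range n, q ^ i

/-- The `q`-factorial. -/
def qFact (n : ℕ) : K := ∏ i ∈ Finset.range n, qNat q (i + 1)

/-- The complete homogeneous symmetric polynomial of degree `r` in `1, q, …, q^(w-1)`. -/
def qComplete (r w : ℕ) : K := (∏ j ∈ Finset.range r, qNat q (w + j)) / qFact q r

/-- The elementary symmetric polynomial of degree `r` in `1, q, …, q^(w-1)`. -/
def qElem (r w : ℕ) : K :=
  q ^ r.choose 2 * (∏ j ∈ Finset.range r, qNat q (w - j)) / qFact q r

@[simp] theorem qNat_zero : qNat q 0 = 0 := by simp [qNat]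

@[simp] theorem qNat_one : qNat q 1 = 1 := by simp [qNat]

theorem qNat_add (a b : ℕ) : qNat q (a + b) = qNat q a + q ^ a * qNat q b := by
  simp [qNat, Finset.sum_range_add, Finset.mul_sum, pow_add]

theorem qFact_succ (n : ℕ) : qFact q (n + 1) = qFact q n * qNat q (n + 1) := by
  simp [qFact, Finset.prod_range_succ]

@[simp] theorem qComplete_zero_left (w : ℕ) : qComplete q 0 w = 1 := by simp [qComplete, qFact]

@[simp] theorem qComplete_succ_zero (r : ℕ) : qComplete q (r + 1) 0 = 0 := by
  simp [qComplete, Finset.prod_range_succ']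

@[simp] theorem qElem_zero_left (w : ℕ) : qElem q 0 w = 1 := by simp [qElem, qFact]

@[simp] theorem qElem_succ_zero (r : ℕ) : qElem q (r + 1) 0 = 0 := by
  simp [qElem]

variable {q}

theorem qFact_ne_zero (hq : ∀ n, qNat q (n + 1) ≠ 0) (n : ℕ) : qFact q n ≠ 0 :=
  Finset.prod_ne_zero_iff.2 fun i _ => hq i

/-- Monomials containing the variable `1` give the second term; the others use only `q, …, q^w`, a
rescaling by `q` of `1, …, q^(w-1)`. -/
theorem qComplete_succ_succ (hq : ∀ n, qNat q (n + 1) ≠ 0) (r w : ℕ) :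
    qComplete q (r + 1) (w + 1)
      = q ^ (r + 1) * qComplete q (r + 1) w + qComplete q r (w + 1) := by
  have h1 := qFact_ne_zero hq r
  have h2 := hq r
  have e1 : ∏ j ∈ Finset.range (r + 1), qNat q (w + j)
      = qNat q w * ∏ j ∈ Finset.range r, qNat q (w + 1 + j) := by
    rw [Finset.prod_range_succ', mul_comm]
    simp only [Nat.add_zero, Nat.add_assoc, Nat.add_comm 1]
  have e2 : qNat q (w + 1 + r) = qNat q (r + 1) + q ^ (r + 1) * qNat q w := by
    rw [← qNat_add]; congr 1; ring
  rw [qComplete, qComplete, qComplete, e1, Finset.prod_range_succ, qFact_succ, e2]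
  field_simp
  ring

/-- Here the monomials are split according to the largest variable `q^w`. -/
theorem qComplete_succ_succ' (hq : ∀ n, qNat q (n + 1) ≠ 0) (r w : ℕ) :
    qComplete q (r + 1) (w + 1)
      = qComplete q (r + 1) w + q ^ w * qComplete q r (w + 1) := by
  have h1 := qFact_ne_zero hq r
  have h2 := hq r
  have e1 : ∏ j ∈ Finset.range (r + 1), qNat q (w + j)
      = qNat q w * ∏ j ∈ Finset.range r, qNat q (w + 1 + j) := by
    rw [Finset.prod_range_succ', mul_comm]
    simp only [Nat.add_zero, Nat.add_assoc, Nat.add_comm 1]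
  have e2 : qNat q (w + 1 + r) = qNat q w + q ^ w * qNat q (r + 1) := by
    rw [← qNat_add]; congr 1; ring
  rw [qComplete, qComplete, qComplete, e1, Finset.prod_range_succ, qFact_succ, e2]
  field_simp

theorem prod_qNat_sub_eq_zero {r w : ℕ} (h : w < r) :
    ∏ j ∈ Finset.range r, qNat q (w - j) = 0 :=
  Finset.prod_eq_zero (Finset.mem_range.2 h) (by simp)

/-- Squarefree monomials are split according to the variable `1`; the remaining variables are
rescaled by `q`. -/
theorem qElem_succ_succ (hq : ∀ n, qNat q (n + 1) ≠ 0) (r w : ℕ) :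
    qElem q (r + 1) (w + 1) = q ^ (r + 1) * qElem q (r + 1) w + q ^ r * qElem q r w := by
  have h1 := qFact_ne_zero hq r
  have h2 := hq r
  have e1 : ∏ j ∈ Finset.range (r + 1), qNat q (w + 1 - j)
      = qNat q (w + 1) * ∏ j ∈ Finset.range r, qNat q (w - j) := by
    rw [Finset.prod_range_succ', mul_comm]
    simp
  have e3 : (r + 1).choose 2 = r.choose 2 + r := by
    rw [Nat.choose_succ_succ' r 1]; simp [add_comm]
  rw [qElem, qElem, qElem, e1, Finset.prod_range_succ, qFact_succ, e3]
  rcases lt_or_ge w r with h | h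
  · simp [prod_qNat_sub_eq_zero h]
  · have e2 : qNat q (w + 1) = qNat q (r + 1) + q ^ (r + 1) * qNat q (w - r) := by
      rw [← qNat_add]; congr 1; omega
    rw [e2]
    field_simp
    ring

/-- Both products run over the same `q`-integers from `w` down to `w - r`. This is the source of the
corrections by marked zeros in the main ratio. -/
theorem qNat_sub_mul_qElem (r w : ℕ) :
    qNat q (w - r) * qElem q r w = qNat q w * qElem q r (w - 1) := by
  have e : (∏ j ∈ Finset.range r, qNat q (w - j)) * qNat q (w - r)
      = qNat q w * ∏ j ∈ Finset.range r, qNat q (w - 1 - j) := by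
    rw [← Finset.prod_range_succ (fun j => qNat q (w - j)), Finset.prod_range_succ', mul_comm]
    simp [Nat.sub_sub, add_comm]
  rw [qElem, qElem]
  linear_combination (q ^ r.choose 2 / qFact q r) * e

theorem qElem_eq_zero {r w : ℕ} (h : w < r) : qElem q r w = 0 := by
  simp [qElem, prod_qNat_sub_eq_zero h]

theorem prod_qNat_mul_qFact (w r : ℕ) :
    (∏ j ∈ Finset.range r, qNat q (w + 1 + j)) * qFact q w = qFact q (w + r) := by
  rw [qFact, qFact, Finset.prod_range_add, mul_comm]
  simp [add_right_comm]

/-! ### The exchange symmetry between two adjacent diagonals -/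

/-- The number of elements of `R` less than `c` plus the number of elements of `E` greater
than `c`. -/
def crossing (R E : Multiset ℕ) (c : ℕ) : ℕ := R.countP (· < c) + E.countP (c < ·)

theorem countP_lt_succ (R : Multiset ℕ) (c : ℕ) :
    R.countP (· < c + 1) = R.countP (· < c) + R.count c := by
  induction R using Multiset.induction with
  | empty => simp
  | cons a R ih =>
    simp only [Multiset.countP_cons, Multiset.count_cons, ih]
    split_ifs <;> omega

theorem countP_gt_succ (E : Multiset ℕ) (c : ℕ) :
    E.countP (c < ·) = E.countP (c + 1 < ·) + E.count (c + 1) := by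
  induction E using Multiset.induction with
  | empty => simp
  | cons a E ih =>
    simp only [Multiset.countP_cons, Multiset.count_cons, ih]
    split_ifs <;> omega

/-- Both sides count the elements of `R` that are at most `c` and the elements of `E` that exceed
`c`. This drives the telescoping below. -/
theorem crossing_succ (R E : Multiset ℕ) (c : ℕ) :
    crossing R E (c + 1) + E.count (c + 1) = crossing R E c + R.count c := by
  have h1 := countP_lt_succ R c
  have h2 := countP_gt_succ E c
  simp only [crossing]
  omega

theorem countP_zero_lt_add (E : Multiset ℕ) : E.countP (0 < ·) + E.count 0 = E.card := by
  induction E using Multiset.induction with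
  | empty => simp
  | cons a E ih =>
    simp only [Multiset.countP_cons, Multiset.count_cons, Multiset.card_cons, ← ih]
    split_ifs <;> omega

/-- If `R` has nothing below `c` and `E` nothing above it, the crossing number already vanishes at
the maximum of `E`, where the factor is a positive-degree polynomial in no variables. -/
theorem prod_qComplete_eq_zero_of_crossing_eq_zero {R E : Multiset ℕ} {C c : ℕ}
    (hE : ∀ e ∈ E, e < C) (hE0 : E ≠ 0) (h : crossing R E c = 0) :
    ∏ d ∈ Finset.range C, qComplete q (E.count d) (crossing R E d) = 0 := by
  obtain ⟨e, he, hmax⟩ := Multiset.exists_max_image id hE0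
  have h1 : R.countP (· < c) = 0 ∧ E.countP (c < ·) = 0 := by simp only [crossing] at h; omega
  have h2 := Multiset.countP_eq_zero.1 h1.1
  have h3 := Multiset.countP_eq_zero.1 h1.2
  have hz : crossing R E e = 0 := by
    have a1 : R.countP (· < e) = 0 := Multiset.countP_eq_zero.2 fun r hr hlt =>
      h2 r hr (lt_of_lt_of_le hlt (not_lt.1 (h3 e he)))
    have a2 : E.countP (e < ·) = 0 := Multiset.countP_eq_zero.2 fun r hr =>
      not_lt.2 (hmax r hr)
    simp [crossing, a1, a2]
  refine Finset.prod_eq_zero (Finset.mem_range.2 (hE e he)) ?_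
  obtain ⟨k, hk⟩ := Nat.exists_eq_succ_of_ne_zero (Multiset.count_pos.2 he).ne'
  rw [hz, hk, qComplete_succ_zero]

/-- The mirror argument, at the minimum of `R`. -/
theorem prod_qComplete_eq_zero_of_crossing_eq_zero' {R E : Multiset ℕ} {C c : ℕ}
    (hR : ∀ e ∈ R, e < C) (hR0 : R ≠ 0) (h : crossing R E c = 0) :
    ∏ d ∈ Finset.range C, qComplete q (R.count d) (crossing R E d) = 0 := by
  obtain ⟨e, he, hmin⟩ := Multiset.exists_min_image id hR0
  have h1 : R.countP (· < c) = 0 ∧ E.countP (c < ·) = 0 := by simp only [crossing] at h; omega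
  have h2 := Multiset.countP_eq_zero.1 h1.1
  have h3 := Multiset.countP_eq_zero.1 h1.2
  have hz : crossing R E e = 0 := by
    have a1 : R.countP (· < e) = 0 := Multiset.countP_eq_zero.2 fun r hr =>
      not_lt.2 (hmin r hr)
    have a2 : E.countP (e < ·) = 0 := Multiset.countP_eq_zero.2 fun r hr hlt =>
      h3 r hr (lt_of_le_of_lt (not_lt.1 (h2 e he)) hlt)
    simp [crossing, a1, a2]
  refine Finset.prod_eq_zero (Finset.mem_range.2 (hR e he)) ?_
  obtain ⟨k, hk⟩ := Nat.exists_eq_succ_of_ne_zero (Multiset.count_pos.2 he).ne'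
  rw [hz, hk, qComplete_succ_zero]

theorem qComplete_mul_qFact (hq : ∀ n, qNat q (n + 1) ≠ 0) {w : ℕ} (hw : 0 < w) (r : ℕ) :
    qComplete q r w * qFact q r * qFact q (w - 1) = qFact q (w + r - 1) := by
  obtain ⟨w, rfl⟩ := Nat.exists_eq_succ_of_ne_zero hw.ne'
  have h1 := qFact_ne_zero hq r
  rw [qComplete, div_mul_cancel₀ _ h1]
  have := prod_qNat_mul_qFact (q := q) w r
  simp only [Nat.succ_eq_add_one, Nat.add_sub_cancel]
  rw [this]
  congr 1
  omega

/-- The symmetry between inserting `E` above `R` and inserting `R` below `E`. -/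
theorem prod_qComplete_symm (hq : ∀ n, qNat q (n + 1) ≠ 0) {R E : Multiset ℕ} {C : ℕ}
    (hR : ∀ e ∈ R, e < C) (hE : ∀ e ∈ E, e < C) (hR0 : R ≠ 0) (hE0 : E ≠ 0) :
    (∏ c ∈ Finset.range C, qComplete q (E.count c) (crossing R E c)) *
        (∏ c ∈ Finset.range C, qFact q (E.count c)) * qFact q (R.card - 1)
      = (∏ c ∈ Finset.range C, qComplete q (R.count c) (crossing R E c)) *
        (∏ c ∈ Finset.range C, qFact q (R.count c)) * qFact q (E.card - 1) := by
  by_cases h : ∃ c < C, crossing R E c = 0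
  · obtain ⟨c, -, h⟩ := h
    rw [prod_qComplete_eq_zero_of_crossing_eq_zero hE hE0 h,
      prod_qComplete_eq_zero_of_crossing_eq_zero' hR hR0 h]
    ring
  · push Not at h
    -- With `w` the crossing number, `h_r(w) [r]! = [w + r - 1]! / [w - 1]!`. By `crossing_succ` the
    -- numerator for `E` at `c + 1` equals the numerator for `R` at `c`, so the two partial products
    -- differ only by their boundary factorials.
    have key : ∀ D ≤ C, 0 < D →
        (∏ c ∈ Finset.range D, qComplete q (E.count c) (crossing R E c)) *
          (∏ c ∈ Finset.range D, qFact q (E.count c)) *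
          qFact q (crossing R E (D - 1) + R.count (D - 1) - 1)
        = (∏ c ∈ Finset.range D, qComplete q (R.count c) (crossing R E c)) *
          (∏ c ∈ Finset.range D, qFact q (R.count c)) * qFact q (E.card - 1) := by
      intro D
      induction D with
      | zero => intro _ h0; omega
      | succ D ih =>
        intro hD _
        have hpos : 0 < crossing R E D := Nat.pos_of_ne_zero (h D (by omega))
        have a1 := qComplete_mul_qFact hq hpos (E.count D)
        have a2 := qComplete_mul_qFact hq hpos (R.count D)
        have a3 := qFact_ne_zero hq (crossing R E D - 1)
        simp only [Finset.prod_range_succ, Nat.add_sub_cancel]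
        rw [← a2]
        rcases Nat.eq_zero_or_pos D with rfl | hD0
        · have : crossing R E 0 + E.count 0 = E.card := by
            rw [← countP_zero_lt_add E]; simp [crossing]
          rw [this] at a1
          rw [← a1]
          simp only [Finset.range_zero, Finset.prod_empty]
          ring
        · have ih := ih (by omega) hD0
          obtain ⟨D, rfl⟩ := Nat.exists_eq_succ_of_ne_zero hD0.ne'
          simp only [Nat.succ_eq_add_one, Nat.add_sub_cancel] at *
          rw [← crossing_succ, ← a1] at ih
          linear_combination (qComplete q (R.count (D + 1)) (crossing R E (D + 1))
            * qFact q (R.count (D + 1))) * ih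
    have hC : 0 < C := by
      obtain ⟨e, he⟩ := Multiset.exists_mem_of_ne_zero hE0
      exact lt_of_le_of_lt (Nat.zero_le _) (hE e he)
    have hfin : crossing R E (C - 1) + R.count (C - 1) = R.card := by
      obtain ⟨D, rfl⟩ := Nat.exists_eq_succ_of_ne_zero hC.ne'
      simp only [Nat.succ_eq_add_one, Nat.add_sub_cancel] at *
      have b1 := countP_lt_succ R D
      have b2 : R.countP (· < D + 1) = R.card := Multiset.countP_eq_card.2 hR
      have b3 : E.countP (D < ·) = 0 :=
        Multiset.countP_eq_zero.2 fun e he => by have := hE e he; omega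
      simp only [crossing]
      omega
    have := key C le_rfl hC
    rwa [hfin] at this

/-- The symmetry with `R = {0}`: the other side has a single nontrivial factor, `h_1` at the label
`0`. -/
theorem prod_qComplete_singleton (hq : ∀ n, qNat q (n + 1) ≠ 0) {E : Multiset ℕ} {C : ℕ}
    (hE : ∀ e ∈ E, e < C) (hE0 : E ≠ 0) :
    (∏ c ∈ Finset.range C, qComplete q (E.count c) (crossing {0} E c)) *
        (∏ c ∈ Finset.range C, qFact q (E.count c))
      = qNat q (E.countP (0 < ·)) * qFact q (E.card - 1) := by
  have hC : 0 < C := by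
    obtain ⟨e, he⟩ := Multiset.exists_mem_of_ne_zero hE0
    exact lt_of_le_of_lt (Nat.zero_le _) (hE e he)
  have h := prod_qComplete_symm hq (R := {0}) (by simpa using hC) hE (by simp) hE0
  have e1 : ∏ c ∈ Finset.range C, qComplete q (Multiset.count c {0}) (crossing {0} E c)
      = qNat q (E.countP (0 < ·)) := by
    rw [Finset.prod_eq_single_of_mem 0 (Finset.mem_range.2 hC)]
    · simp [qComplete, qFact, crossing]
    · intro c _ hc
      simp [hc]
  have e2 : ∏ c ∈ Finset.range C, qFact q (Multiset.count c {0}) = 1 := by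
    refine Finset.prod_eq_one fun c _ => ?_
    rw [Multiset.count_singleton]
    split_ifs <;> simp [qFact]
  rw [e1, e2] at h
  simpa [qFact] using h

/-- Evaluating both one-level products by `prod_qComplete_singleton` reduces the claim to
`prod_qComplete_symm`; the factorials of the cardinalities cancel. -/
theorem two_level_identity (hq : ∀ n, qNat q (n + 1) ≠ 0) {R E : Multiset ℕ} {C : ℕ}
    (hR : ∀ e ∈ R, e < C) (hE : ∀ e ∈ E, e < C) :
    qNat q (R.countP (0 < ·)) *
        ((∏ c ∈ Finset.range C, qComplete q (R.count c) (crossing R E c)) *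
          ∏ c ∈ Finset.range C, qComplete q (E.count c) (crossing {0} E c))
      = qNat q (E.countP (0 < ·)) *
        ((∏ c ∈ Finset.range C, qComplete q (E.count c) (crossing R E c)) *
          ∏ c ∈ Finset.range C, qComplete q (R.count c) (crossing {0} R c)) := by
  -- Empty multisets are treated apart because `card - 1` is truncated there; both sides then
  -- vanish.
  rcases eq_or_ne E 0 with rfl | hE0
  · rcases eq_or_ne R 0 with rfl | hR0
    · simp
    · rw [prod_qComplete_eq_zero_of_crossing_eq_zero' (c := 0) hR hR0
        (by simp [crossing])]
      simp
  rcases eq_or_ne R 0 with rfl | hR0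
  · obtain ⟨D, hD⟩ : ∃ D, C = D + 1 := by
      obtain ⟨e, he⟩ := Multiset.exists_mem_of_ne_zero hE0
      exact ⟨C - 1, by have := hE e he; omega⟩
    rw [prod_qComplete_eq_zero_of_crossing_eq_zero (R := 0) (c := D) hE hE0]
    · simp
    · simp only [crossing, Multiset.countP_zero, zero_add]
      exact Multiset.countP_eq_zero.2 fun e he => by have := hE e he; omega
  have h1 := prod_qComplete_symm hq hR hE hR0 hE0
  have h2 := prod_qComplete_singleton hq hE hE0
  have h3 := prod_qComplete_singleton hq hR hR0
  have n1 : ∏ c ∈ Finset.range C, qFact q (E.count c) ≠ 0 :=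
    Finset.prod_ne_zero_iff.2 fun c _ => qFact_ne_zero hq _
  have n2 : ∏ c ∈ Finset.range C, qFact q (R.count c) ≠ 0 :=
    Finset.prod_ne_zero_iff.2 fun c _ => qFact_ne_zero hq _
  refine mul_right_cancel₀ (mul_ne_zero n1 n2) ?_
  set A := ∏ c ∈ Finset.range C, qComplete q (R.count c) (crossing R E c)
  set B := ∏ c ∈ Finset.range C, qComplete q (E.count c) (crossing R E c)
  set FE := ∏ c ∈ Finset.range C, qFact q (E.count c)
  set FR := ∏ c ∈ Finset.range C, qFact q (R.count c)
  linear_combination (qNat q (R.countP (0 < ·)) * A * FR) * h2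
    - (qNat q (E.countP (0 < ·)) * B * FE) * h3
    - (qNat q (R.countP (0 < ·)) * qNat q (E.countP (0 < ·))) * h1

end QNumbers

/-! ### Paths as words of rows -/

/-- A row of a labelled path: the index of its diagonal (counted from the lowest one), its label
and its decoration. -/
abbrev Row : Type := ℤ × ℕ × Bool

/-- What the admissible continuations of a labelled path depend on: the diagonal and the label of
the last row, and whether the path may end there. -/
structure Origin where
  level : ℤ
  label : ℕ
  final : Bool

/-- The last row of a path of shift `s` as an origin. -/
def rowOrigin (s : ℤ) (y : Row) : Origin := ⟨y.1, y.2.1, decide (s ≤ y.1)⟩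

/-- The beginning of a path of shift `s` imposes the same conditions as a row labelled `0` on the
diagonal below the main one. -/
def startOrigin (s : ℤ) : Origin := ⟨s - 1, 0, true⟩

/-- The row `y` may come right after `p`. -/
def Follows (p : Origin) (y : Row) : Prop :=
  y.1 ≤ p.level + 1 ∧ (y.1 = p.level + 1 → p.label < y.2.1) ∧
    (y.2.2 = true → y.1 < p.level ∨ (y.1 = p.level ∧ p.label < y.2.1))

instance (p : Origin) (y : Row) : Decidable (Follows p y) := by
  unfold Follows; infer_instance

/-- The row `y` forms an inversion that counts with any later row `x`. -/
def Attacks (y x : Row) : Prop :=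
  y.2.2 = false ∧ ((y.1 = x.1 ∧ y.2.1 < x.2.1) ∨ (y.1 = x.1 + 1 ∧ x.2.1 < y.2.1))

instance (y x : Row) : Decidable (Attacks y x) := by
  unfold Attacks; infer_instance

/-- The list of rows is a path of shift `s` that starts from `p`. -/
def IsPathFrom (s : ℤ) : Origin → List Row → Prop
  | p, [] => p.final = true
  | p, y :: l => Follows p y ∧ IsPathFrom s (rowOrigin s y) l

instance decidableIsPathFrom (s : ℤ) : ∀ (p : Origin) (l : List Row), Decidable (IsPathFrom s p l)
  | p, [] => by unfold IsPathFrom; infer_instance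
  | p, y :: l => by
    unfold IsPathFrom
    have := decidableIsPathFrom s (rowOrigin s y) l
    infer_instance

/-- The number of inversions whose left row is not decorated. -/
def inversions : List Row → ℕ
  | [] => 0
  | y :: l => l.countP (fun x => Attacks y x) + inversions l

/-! ### Path sums and their expansion along the first row -/

section PathSum

variable {K : Type*} [Field K] (q : K) (s : ℤ)

/-- The words with a given multiset of letters. -/
def orderings (M : Multiset Row) : Finset (List Row) := M.lists.toFinset

theorem mem_orderings {M : Multiset Row} {l : List Row} :
    l ∈ orderings M ↔ M = (l : Multiset Row) := by
  rw [orderings, Multiset.mem_toFinset, Multiset.mem_lists_iff]; rfl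

theorem countP_replicate_row (P : Row → Prop) [DecidablePred P] (n : ℕ) (x : Row) :
    (Multiset.replicate n x).countP P = if P x then n else 0 := by
  induction n with
  | zero => simp
  | succ n ih => rw [Multiset.replicate_succ, Multiset.countP_cons, ih]; split_ifs <;> simp

/-- The sum of `q ^ inversions` over the paths of shift `s` from `p` with rows `M`. -/
def pathSum (p : Origin) (M : Multiset Row) : K :=
  ∑ l ∈ orderings M with IsPathFrom s p l, q ^ inversions l

theorem pathSum_zero (p : Origin) : pathSum q s p 0 = if p.final then 1 else 0 := by
  have : orderings (0 : Multiset Row) = {[]} := by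
    ext l
    rw [mem_orderings, Finset.mem_singleton]
    constructor
    · intro h
      exact (Multiset.coe_eq_zero l).1 h.symm
    · rintro rfl; rfl
  rw [pathSum, this, Finset.filter_singleton]
  by_cases h : p.final = true <;> simp [IsPathFrom, h, inversions]

/-- The contribution to a path sum of the paths whose first row is `y`. -/
def branch (M : Multiset Row) (y : Row) : K :=
  q ^ (M.erase y).countP (fun x => Attacks y x) * pathSum q s (rowOrigin s y) (M.erase y)

theorem pathSum_of_ne_zero (p : Origin) {M : Multiset Row} (hM : M ≠ 0) :
    pathSum q s p M = ∑ y ∈ M.toFinset, if Follows p y then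
      branch q s M y else 0 := by
  unfold branch
  have key : ∀ y ∈ M.toFinset, (if Follows p y then
      q ^ (M.erase y).countP (fun x => Attacks y x) * pathSum q s (rowOrigin s y) (M.erase y)
      else 0) = ∑ l ∈ orderings (M.erase y) with IsPathFrom s p (y :: l), q ^ inversions (y :: l) := by
    intro y _
    split_ifs with h
    · rw [pathSum, Finset.mul_sum]
      refine Finset.sum_congr ?_ fun l hl => ?_
      · ext l; simp [IsPathFrom, h]
      · have hl := mem_orderings.1 (Finset.mem_filter.1 hl).1
        have : (M.erase y).countP (fun x => Attacks y x) = l.countP (fun x => Attacks y x) := by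
          rw [hl]; exact Multiset.coe_countP _ l
        rw [this, inversions, pow_add]
    · rw [Finset.sum_eq_zero]
      intro l hl
      exact absurd (Finset.mem_filter.1 hl).2.1 h
  rw [Finset.sum_congr rfl key, Finset.sum_sigma', pathSum]
  symm
  refine Finset.sum_bij (fun a _ => a.1 :: a.2) ?_ ?_ ?_ ?_
  · rintro ⟨y, l⟩ h
    simp only [Finset.mem_sigma, Multiset.mem_toFinset, Finset.mem_filter,
      mem_orderings] at h ⊢
    refine ⟨?_, h.2.2⟩
    rw [← Multiset.cons_erase h.1, h.2.1]
    rfl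
  · rintro ⟨y, l⟩ _ ⟨y', l'⟩ _ h
    simp only [List.cons.injEq] at h
    obtain ⟨rfl, rfl⟩ := h
    rfl
  · intro l hl
    simp only [Finset.mem_filter, mem_orderings] at hl
    cases l with
    | nil => exact absurd hl.1 hM
    | cons y l =>
      have hy : M = y ::ₘ (l : Multiset Row) := hl.1
      refine ⟨⟨y, l⟩, ?_, rfl⟩
      simp only [Finset.mem_sigma, Multiset.mem_toFinset, Finset.mem_filter,
        mem_orderings]
      refine ⟨by rw [hy]; simp, ?_, hl.2⟩
      rw [hy, Multiset.erase_cons_head]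
  · intro a _
    rfl

theorem not_attacks_self (x : Row) : ¬ Attacks x x := by
  simp [Attacks]

theorem pathSum_add_replicate (p : Origin) {M : Multiset Row} {x : Row} (hx : x ∉ M) (r : ℕ) :
    pathSum q s p (M + Multiset.replicate (r + 1) x)
      = (∑ y ∈ M.toFinset, if Follows p y then
          q ^ (M.erase y).countP (fun x => Attacks y x) *
            ((if Attacks y x then q ^ (r + 1) else 1) *
              pathSum q s (rowOrigin s y) (M.erase y + Multiset.replicate (r + 1) x)) else 0)
        + if Follows p x then q ^ M.countP (fun y => Attacks x y) *
            pathSum q s (rowOrigin s x) (M + Multiset.replicate r x) else 0 := by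
  rw [pathSum_of_ne_zero _ _ _ (by simp), Multiset.toFinset_add, Multiset.toFinset_replicate,
    if_neg (Nat.succ_ne_zero r), Finset.sum_union (by simpa using hx), Finset.sum_singleton]
  congr 1
  · refine Finset.sum_congr rfl fun y hy => ?_
    have hy := Multiset.mem_toFinset.1 hy
    rw [branch, Multiset.erase_add_left_pos _ hy, Multiset.countP_add]
    congr 1
    rw [pow_add, mul_assoc]
    congr 2
    rw [countP_replicate_row]
    split_ifs <;> simp
  · rw [branch, Multiset.erase_add_right_neg _ hx, Multiset.replicate_succ, Multiset.erase_cons_head,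
      Multiset.countP_add, countP_replicate_row, if_neg (not_attacks_self x), add_zero]

/-- The induction step shared by the insertion lemmas: `κ y` is the insertion factor already known
for paths that begin with `y`, including the inversions of `y` with the inserted rows. -/
theorem pathSum_add_replicate_of_branch (p : Origin) {M : Multiset Row} {x : Row} (hx : x ∉ M)
    (r : ℕ) (κ : Row → K)
    (h : ∀ y ∈ M, Follows p y → (if Attacks y x then q ^ (r + 1) else 1) *
      pathSum q s (rowOrigin s y) (M.erase y + Multiset.replicate (r + 1) x)
        = κ y * pathSum q s (rowOrigin s y) (M.erase y)) :
    pathSum q s p (M + Multiset.replicate (r + 1) x)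
      = (∑ y ∈ M.toFinset, if Follows p y then κ y * branch q s M y else 0)
        + if Follows p x then q ^ M.countP (fun y => Attacks x y) *
            pathSum q s (rowOrigin s x) (M + Multiset.replicate r x) else 0 := by
  rw [pathSum_add_replicate _ _ _ hx]
  congr 1
  refine Finset.sum_congr rfl fun y hy => ?_
  split_ifs with hf
  · have := h y (Multiset.mem_toFinset.1 hy) hf
    rw [branch, mul_left_comm (κ y), ← this]
    simp [*]
  · have := h y (Multiset.mem_toFinset.1 hy) hf
    rw [branch, mul_left_comm (κ y), ← this]
    simp [*]
  · rfl

theorem countP_erase_add {M : Multiset Row} {y : Row} (hy : y ∈ M) (P : Row → Prop)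
    [DecidablePred P] :
    (M.erase y).countP P + (if P y then 1 else 0) = M.countP P := by
  conv_rhs => rw [← Multiset.cons_erase hy, Multiset.countP_cons]

variable {q}

/-! ### Insertion of equal rows -/

/-- Insertion, on a diagonal below the main one, of the rows that are next in increasing order. -/
theorem pathSum_insert_below (hq : ∀ n, qNat q (n + 1) ≠ 0) {i : ℤ} (hi : i < s) (c : ℕ) :
    ∀ (n r : ℕ) (M : Multiset Row) (p : Origin), M.card + r = n →
      (∀ y ∈ M, y.2.2 = false ∧ i ≤ y.1 ∧ (y.1 = i → y.2.1 < c)) →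
      i ≤ p.level → (p.level = i → p.label ≤ c) →
      pathSum q s p (M + Multiset.replicate r (i, c, false))
        = qComplete q r (M.countP fun y => Attacks y (i, c, false)) * pathSum q s p M := by
  intro n
  induction n using Nat.strong_induction_on with
  | _ n ih =>
  intro r M p hn hM hp1 hp2
  have hx : (i, c, false) ∉ M := fun h => by have := (hM _ h).2.2 rfl; simp at this
  cases r with
  | zero => simp
  | succ r =>
  set x : Row := (i, c, false) with hxdef
  have hpx : Follows p x := by
    refine ⟨?_, ?_, ?_⟩ <;> simp [hxdef]
    · omega
    · intro h; omega
  have hxx : M.countP (fun y => Attacks x y) = 0 := by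
    refine Multiset.countP_eq_zero.2 fun y hy h => ?_
    have := hM y hy
    simp only [Attacks, hxdef] at h
    omega
  -- After `x` the path is on its lowest level, at the largest label there, so the rows allowed next
  -- are exactly those that attack `x`. The path cannot end at `x` because `i < s`.
  have hMx : pathSum q s (rowOrigin s x) M = ∑ y ∈ M.toFinset,
      if Follows p y ∧ Attacks y x then branch q s M y else 0 := by
    rcases eq_or_ne M 0 with rfl | hM0
    · rw [pathSum_zero]; simp [rowOrigin, hxdef, hi]
    · rw [pathSum_of_ne_zero _ _ _ hM0]
      refine Finset.sum_congr rfl fun y hy => ?_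
      have hy := hM y (Multiset.mem_toFinset.1 hy)
      have : Follows (rowOrigin s x) y ↔ Follows p y ∧ Attacks y x := by
        simp only [Follows, Attacks, rowOrigin, hxdef, hy.1]
        simp
        omega
      simp only [this]
  have hMp : M ≠ 0 → pathSum q s p M = pathSum q s (rowOrigin s x) M
      + ∑ y ∈ M.toFinset, if Follows p y ∧ ¬ Attacks y x then branch q s M y else 0 := by
    intro hM0
    rw [pathSum_of_ne_zero _ _ _ hM0, hMx, ← Finset.sum_add_distrib]
    refine Finset.sum_congr rfl fun y _ => ?_
    by_cases h1 : Follows p y <;> by_cases h2 : Attacks y x <;> simp [h1, h2]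
  have hrec := ih (M.card + r) (by omega) r M (rowOrigin s x) rfl hM (by simp [rowOrigin, hxdef])
    (by simp [rowOrigin, hxdef])
  obtain ⟨a, ha⟩ : ∃ a, M.countP (fun y => Attacks y x) = a := ⟨_, rfl⟩
  rw [pathSum_add_replicate_of_branch q s p hx r (fun y => if Attacks y x then
    q ^ (r + 1) * qComplete q (r + 1) (a - 1) else qComplete q (r + 1) a), if_pos hpx, hxx, hrec, ha]
  swap
  · intro y hy _
    have hlt := Multiset.card_erase_lt_of_mem hy
    rw [ih ((M.erase y).card + (r + 1)) (by omega) (r + 1) (M.erase y) (rowOrigin s y) rfl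
      (fun w hw => hM w (Multiset.mem_of_mem_erase hw)) (hM y hy).2.1
      (fun h => ((hM y hy).2.2 h).le)]
    have hc := countP_erase_add hy (fun y => Attacks y x)
    rw [ha] at hc
    by_cases h2 : Attacks y x
    · simp only [h2, if_true] at hc ⊢
      rw [← hc, Nat.add_sub_cancel, mul_assoc]
    · simp only [h2, if_false, add_zero] at hc ⊢
      rw [← hc, one_mul]
  have hsplit : ∀ A B : K, (∑ y ∈ M.toFinset, if Follows p y then
      (if Attacks y x then A else B) * branch q s M y else 0)
      = A * pathSum q s (rowOrigin s x) M
        + B * ∑ y ∈ M.toFinset, if Follows p y ∧ ¬ Attacks y x then branch q s M y else 0 := by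
    intro A B
    rw [hMx, Finset.mul_sum, Finset.mul_sum, ← Finset.sum_add_distrib]
    refine Finset.sum_congr rfl fun y _ => ?_
    by_cases h1 : Follows p y <;> by_cases h2 : Attacks y x <;> simp [h1, h2]
  rw [hsplit]
  rcases eq_or_ne M 0 with rfl | hM0
  · have : a = 0 := by simpa using ha.symm
    subst this
    rw [pathSum_zero]
    simp [rowOrigin, hxdef, hi]
  -- A first row that does not attack `x` leaves the number `a` of variables unchanged; an attacking
  -- one lowers it and costs `q ^ (r + 1)`. The coefficients match by the recurrence of `qComplete`
  -- at the variable `1`.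
  · rw [hMp hM0]
    rcases a with _ | a
    · have : pathSum q s (rowOrigin s x) M = 0 := by
        rw [hMx]
        refine Finset.sum_eq_zero fun y hy => if_neg fun h => ?_
        exact Multiset.countP_eq_zero.1 ha y (Multiset.mem_toFinset.1 hy) h.2
      rw [this]
      simp
    · have := qComplete_succ_succ hq r a
      simp only [Nat.add_sub_cancel]
      linear_combination (-pathSum q s (rowOrigin s x) M) * this

/-- Insertion, on a diagonal not below the main one, of the rows that are next in decreasing
order. -/
theorem pathSum_insert_above (hq : ∀ n, qNat q (n + 1) ≠ 0) {i : ℤ} (hi : s ≤ i) (c : ℕ) :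
    ∀ (n r : ℕ) (M : Multiset Row) (p : Origin), M.card + r = n →
      (∀ y ∈ M, y.2.2 = false ∧ y.1 ≤ i ∧ (y.1 = i → c < y.2.1)) →
      (∀ y ∈ M, Follows (rowOrigin s y) (i, c, false) → s ≤ y.1) →
      p.level ≤ i → (p.level = i → c ≤ p.label) → (Follows p (i, c, false) → p.final = true) →
      pathSum q s p (M + Multiset.replicate r (i, c, false))
        = qComplete q r ((M.countP fun y => Attacks (i, c, false) y)
            + if Follows p (i, c, false) then 1 else 0) * pathSum q s p M := by
  intro n
  induction n using Nat.strong_induction_on with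
  | _ n ih =>
  intro r M p hn hM hMs hp1 hp2 hps
  have hx : (i, c, false) ∉ M := fun h => by have := (hM _ h).2.2 rfl; simp at this
  cases r with
  | zero => simp
  | succ r =>
  set x : Row := (i, c, false) with hxdef
  -- The places where `x` fits are right after the rows it attacks, and possibly at the start.
  have hatt : ∀ y ∈ M, Follows (rowOrigin s y) x ↔ Attacks x y := by
    intro y hy
    have := hM y hy
    simp only [Follows, Attacks, rowOrigin, hxdef]
    simp
    omega
  have hxx : Follows (rowOrigin s x) x := by
    simp [Follows, rowOrigin, hxdef]
  obtain ⟨a, ha⟩ : ∃ a, M.countP (fun y => Attacks x y) = a := ⟨_, rfl⟩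
  have hrec := ih (M.card + r) (by omega) r M (rowOrigin s x) rfl hM hMs
    (by simp [rowOrigin, hxdef]) (by simp [rowOrigin, hxdef]) (by simp [rowOrigin, hxdef, hi])
  rw [if_pos hxx, ha] at hrec
  rw [pathSum_add_replicate_of_branch q s p hx r (fun _ => qComplete q (r + 1) a), hrec, ha]
  swap
  · intro y hy _
    have hlt := Multiset.card_erase_lt_of_mem hy
    rw [ih ((M.erase y).card + (r + 1)) (by omega) (r + 1) (M.erase y) (rowOrigin s y) rfl
      (fun w hw => hM w (Multiset.mem_of_mem_erase hw))
      (fun w hw => hMs w (Multiset.mem_of_mem_erase hw)) (hM y hy).2.1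
      (fun h => ((hM y hy).2.2 h).le) (fun h => by simpa [rowOrigin] using hMs y hy h)]
    have hc := countP_erase_add hy (fun y => Attacks x y)
    rw [ha] at hc
    simp only [hatt y hy, hc]
    have h2 : ¬ Attacks y x := by
      have := hM y hy
      simp only [Attacks, hxdef]
      omega
    rw [if_neg h2, one_mul]
  have hsum : M ≠ 0 → (∑ y ∈ M.toFinset,
      if Follows p y then qComplete q (r + 1) a * branch q s M y else 0)
      = qComplete q (r + 1) a * pathSum q s p M := by
    intro hM0
    rw [pathSum_of_ne_zero _ _ _ hM0, Finset.mul_sum]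
    refine Finset.sum_congr rfl fun y _ => ?_
    split_ifs <;> simp
  by_cases hpx : Follows p x
  -- Any row of `M` may follow `x`, and may equally follow an origin that admits `x`: inserting `x`
  -- does not disturb the continuation.
  · have hpM : pathSum q s (rowOrigin s x) M = pathSum q s p M := by
      rcases eq_or_ne M 0 with rfl | hM0
      · rw [pathSum_zero, pathSum_zero, hps hpx]
        simp [rowOrigin, hxdef, hi]
      · rw [pathSum_of_ne_zero _ _ _ hM0, pathSum_of_ne_zero _ _ _ hM0]
        refine Finset.sum_congr rfl fun y hy => ?_
        have hy := hM y (Multiset.mem_toFinset.1 hy)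
        have : Follows (rowOrigin s x) y ↔ Follows p y := by
          simp only [Follows, rowOrigin, hxdef, hy.1] at hpx ⊢
          simp at hpx ⊢
          omega
        simp only [this]
    rw [if_pos hpx, if_pos hpx, hpM, qComplete_succ_succ' hq]
    rcases eq_or_ne M 0 with rfl | hM0
    · have : a = 0 := by simpa using ha.symm
      subst this
      simp
    · rw [hsum hM0]
      ring
  · rw [if_neg hpx, if_neg hpx, add_zero, add_zero]
    rcases eq_or_ne M 0 with rfl | hM0
    · have : a = 0 := by simpa using ha.symm
      subst this
      simp
    · exact hsum hM0

theorem pathSum_eq_zero_of_not_follows {i : ℤ} (hi : i < s) (c : ℕ) :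
    ∀ (n : ℕ) (M : Multiset Row) (p : Origin), M.card = n →
      (M.countP fun y => Attacks y (i, c, true)) = 0 →
      ¬ Follows p (i, c, true) → p.final = decide (s ≤ p.level) → pathSum q s p M = 0 := by
  intro n
  induction n using Nat.strong_induction_on with
  | _ n ih =>
  intro M p hn hM hp hps
  rcases eq_or_ne M 0 with rfl | hM0
  · rw [pathSum_zero, hps]
    have : ¬ s ≤ p.level := by
      simp only [Follows] at hp
      simp at hp
      omega
    simp [this]
  · rw [pathSum_of_ne_zero _ _ _ hM0]
    refine Finset.sum_eq_zero fun y hy => ?_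
    have hy := Multiset.mem_toFinset.1 hy
    have hlt := Multiset.card_erase_lt_of_mem hy
    split_ifs with h
    · have h2 := Multiset.countP_eq_zero.1 hM y hy
      rw [branch, ih _ (by omega) (M.erase y) (rowOrigin s y) rfl, mul_zero]
      · exact Multiset.countP_eq_zero.2 fun w hw =>
          Multiset.countP_eq_zero.1 hM w (Multiset.mem_of_mem_erase hw)
      · simp only [Follows, Attacks, rowOrigin] at *
        cases hb : y.2.2 <;> simp [hb] at * <;> omega
      · rfl
    · rfl

/-- Insertion of equal decorated rows. -/
theorem pathSum_insert_marked (hq : ∀ n, qNat q (n + 1) ≠ 0) (i : ℤ) (c : ℕ) :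
    ∀ (n r : ℕ) (M : Multiset Row) (p : Origin), M.card + r = n → (i, c, true) ∉ M →
      (s ≤ i → Follows p (i, c, true) → p.final = true) →
      ∀ b, (M.countP fun y => Attacks y (i, c, true)) + (if s ≤ i then 1 else 0) = b →
      pathSum q s p (M + Multiset.replicate r (i, c, true))
        = (if Follows p (i, c, true) then qElem q r b else q ^ r * qElem q r (b - 1))
          * pathSum q s p M := by
  intro n
  induction n using Nat.strong_induction_on with
  | _ n ih =>
  intro r M p hn hx hps b hb
  cases r with
  | zero => simp
  | succ r =>
  set x : Row := (i, c, true) with hxdef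
  -- Equal decorated rows are never adjacent, which is why elementary polynomials appear instead of
  -- complete ones.
  have hxx : ¬ Follows (rowOrigin s x) x := by
    simp [Follows, rowOrigin, hxdef]
  have hx0 : M.countP (fun y => Attacks x y) = 0 :=
    Multiset.countP_eq_zero.2 fun y _ h => by simp [Attacks, hxdef] at h
  have hopen : ∀ y : Row, Attacks y x → Follows (rowOrigin s y) x := by
    intro y hy
    simp only [Follows, Attacks, rowOrigin, hxdef] at hy ⊢
    simp
    omega
  have hrec := ih (M.card + r) (by omega) r M (rowOrigin s x) rfl hx
    (fun h _ => by simpa [rowOrigin, hxdef] using h) b hb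
  rw [if_neg hxx] at hrec
  rw [pathSum_add_replicate_of_branch q s p hx r
    (fun y => if Follows (rowOrigin s y) x ∧ ¬ Attacks y x then qElem q (r + 1) b
      else q ^ (r + 1) * qElem q (r + 1) (b - 1)), hrec, hx0]
  swap
  · intro y hy _
    have hlt := Multiset.card_erase_lt_of_mem hy
    have hc := countP_erase_add hy (fun y => Attacks y x)
    have := ih ((M.erase y).card + (r + 1)) (by omega) (r + 1) (M.erase y) (rowOrigin s y) rfl
      (fun h => hx (Multiset.mem_of_mem_erase h))
      (fun h1 h2 => by
        simp only [Follows, rowOrigin, hxdef] at h2 ⊢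
        simp at h2 ⊢
        omega) _ rfl
    rw [this]
    by_cases h2 : Attacks y x
    · simp only [h2, hopen y h2, if_true, not_true, and_false, if_false] at hc ⊢
      rw [mul_assoc]
      congr 3
      omega
    · simp only [h2, if_false, add_zero, not_false_iff, and_true] at hc ⊢
      rw [hc, hb, one_mul]
  by_cases hpx : Follows p x
  · have hfol : ∀ y ∈ M, Follows (rowOrigin s x) y ↔
        Follows p y ∧ ¬ (Follows (rowOrigin s y) x ∧ ¬ Attacks y x) := by
      rintro ⟨j, d, m⟩ hy
      have hne : ¬ (j = i ∧ d = c ∧ m = true) := by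
        rintro ⟨rfl, rfl, rfl⟩
        exact hx hy
      simp only [Follows, Attacks, rowOrigin, hxdef] at hpx ⊢
      cases m <;> simp at hpx hne ⊢ <;> omega
    have hsplit : ∀ A B : K, (∑ y ∈ M.toFinset, if Follows p y then
        (if Follows (rowOrigin s y) x ∧ ¬ Attacks y x then A else B) * branch q s M y else 0)
        = A * (∑ y ∈ M.toFinset, if Follows p y then branch q s M y else 0)
          + (B - A) * ∑ y ∈ M.toFinset,
            if Follows (rowOrigin s x) y then branch q s M y else 0 := by
      intro A B
      rw [Finset.mul_sum, Finset.mul_sum, ← Finset.sum_add_distrib]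
      refine Finset.sum_congr rfl fun y hy => ?_
      simp only [hfol y (Multiset.mem_toFinset.1 hy)]
      by_cases h1 : Follows p y <;>
        by_cases h2 : Follows (rowOrigin s y) x ∧ ¬ Attacks y x <;>
        simp only [h1, h2, if_true, if_false, and_self, not_true, not_false_iff, and_false,
          false_and, mul_zero, add_zero]
      all_goals ring
    rw [if_pos hpx, if_pos hpx, hsplit]
    -- For `b = 0` the truncated `b - 1` is harmless: a path that has just used `x` can never reach
    -- its end.
    rcases b with _ | b
    · have his : i < s := by
        by_contra h
        rw [if_pos (not_lt.1 h)] at hb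
        omega
      rw [pathSum_eq_zero_of_not_follows s his c _ M (rowOrigin s x) rfl
        (Nat.add_eq_zero_iff.1 hb).1 hxx rfl]
      simp
    · have he := qElem_succ_succ hq r b
      rcases eq_or_ne M 0 with rfl | hM0
      · have his : s ≤ i := by
          by_contra h
          rw [if_neg h] at hb
          simp at hb
        have : b = 0 := by
          rw [if_pos his] at hb
          simpa using hb.symm
        subst this
        rw [pathSum_zero, pathSum_zero, hps his hpx]
        simp only [rowOrigin, hxdef, his] at *
        simp [he]
      · rw [← pathSum_of_ne_zero _ _ _ hM0, ← pathSum_of_ne_zero _ _ _ hM0]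
        simp only [Nat.add_sub_cancel]
        linear_combination (-pathSum q s (rowOrigin s x) M) * he
  · rw [if_neg hpx, if_neg hpx, add_zero]
    rcases eq_or_ne M 0 with rfl | hM0
    · have : b - 1 = 0 := by
        rw [← hb]
        simp
        split_ifs <;> simp
      simp [this]
    · rw [pathSum_of_ne_zero _ _ _ hM0, Finset.mul_sum]
      refine Finset.sum_congr rfl fun y hy => ?_
      split_ifs with h1 h2
      · exfalso
        simp only [Follows, Attacks, rowOrigin, hxdef] at h1 h2 hpx
        cases hm : y.2.2 <;> simp [hm] at h1 h2 hpx <;> omega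
      · rfl
      · simp

end PathSum

/-! ### Comparison of the shifts `s` and `s - 1`: undecorated rows -/

section Ratio

variable {K : Type*} [Field K] {q : K}

theorem filter_ne_add_replicate {α : Type*} [DecidableEq α] (M : Multiset α) (x : α) :
    M.filter (· ≠ x) + Multiset.replicate (M.count x) x = M := by
  rw [← Multiset.filter_eq', add_comm]
  exact Multiset.filter_add_not _ _

theorem card_filter_ne_lt {α : Type*} [DecidableEq α] {M : Multiset α} {x : α} (hx : x ∈ M) :
    (M.filter (· ≠ x)).card < M.card := by
  have h := congrArg Multiset.card (filter_ne_add_replicate M x)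
  have := Multiset.count_pos.2 hx
  rw [Multiset.card_add, Multiset.card_replicate] at h
  omega

/-- Undecorated rows with labels `R` on the diagonal `i`. -/
def rowsAt (i : ℤ) (R : Multiset ℕ) : Multiset Row := R.map fun c => (i, c, false)

theorem mem_rowsAt {i : ℤ} {R : Multiset ℕ} {y : Row} :
    y ∈ rowsAt i R ↔ y.1 = i ∧ y.2.2 = false ∧ y.2.1 ∈ R := by
  rw [rowsAt, Multiset.mem_map]
  constructor
  · rintro ⟨c, hc, rfl⟩
    exact ⟨rfl, rfl, hc⟩
  · obtain ⟨j, c, m⟩ := y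
    rintro ⟨rfl, h, hc⟩
    exact ⟨c, hc, by rw [← h]⟩

theorem rowsAt_add (i : ℤ) (R S : Multiset ℕ) : rowsAt i (R + S) = rowsAt i R + rowsAt i S :=
  Multiset.map_add _ _ _

theorem rowsAt_replicate (i : ℤ) (r c : ℕ) :
    rowsAt i (Multiset.replicate r c) = Multiset.replicate r (i, c, false) :=
  Multiset.map_replicate _ _ _

theorem countP_rowsAt (P : Row → Prop) [DecidablePred P] (i : ℤ) (R : Multiset ℕ) :
    (rowsAt i R).countP P = R.countP fun c => P (i, c, false) := by
  rw [rowsAt, Multiset.countP_map, Multiset.countP_eq_card_filter]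

theorem filter_lt_succ (R : Multiset ℕ) (C : ℕ) :
    R.filter (· < C + 1) = R.filter (· < C) + Multiset.replicate (R.count C) C := by
  ext d
  simp only [Multiset.count_filter, Multiset.count_add, Multiset.count_replicate]
  rcases lt_trichotomy d C with h | rfl | h
  · simp [h, h.ne', Nat.lt_succ_of_lt h]
  · simp
  · simp [h.ne, not_lt.2 h.le, not_lt.2 (Nat.succ_le_of_lt h)]

theorem filter_ge (R : Multiset ℕ) (C : ℕ) :
    R.filter (C ≤ ·) = R.filter (C + 1 ≤ ·) + Multiset.replicate (R.count C) C := by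
  ext d
  simp only [Multiset.count_filter, Multiset.count_add, Multiset.count_replicate]
  rcases lt_trichotomy d C with h | rfl | h
  · simp [h.ne', not_le.2 h, not_le.2 (Nat.lt_succ_of_lt h)]
  · simp
  · simp [h.ne, h.le, Nat.succ_le_of_lt h]

/-- The labels `R` are inserted below the main diagonal in increasing order. A new label `c` is
attacked by the smaller labels of `R` and by the larger labels of `E`, which is the crossing number.
-/
theorem pathSum_rowsAt_below (hq : ∀ n, qNat q (n + 1) ≠ 0) (s : ℤ) (E R : Multiset ℕ) (C : ℕ) :
    pathSum q s (startOrigin s) (rowsAt s E + rowsAt (s - 1) (R.filter (· < C)))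
      = (∏ c ∈ Finset.range C, qComplete q (R.count c) (crossing R E c))
        * pathSum q s (startOrigin s) (rowsAt s E) := by
  induction C with
  | zero => simp [rowsAt]
  | succ C ih =>
    rw [filter_lt_succ, rowsAt_add, rowsAt_replicate, ← add_assoc,
      pathSum_insert_below s hq (by omega) C _ _ _ _ rfl, ih, Finset.prod_range_succ]
    · have : ((rowsAt s E + rowsAt (s - 1) (R.filter (· < C))).countP
          fun y => Attacks y (s - 1, C, false)) = crossing R E C := by
        rw [Multiset.countP_add, countP_rowsAt, countP_rowsAt, Multiset.countP_filter, crossing,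
          add_comm]
        congr 1
        · refine Multiset.countP_congr rfl fun c _ => ?_
          simp [Attacks]
        · refine Multiset.countP_congr rfl fun c _ => ?_
          simp [Attacks]
          omega
      rw [this]
      ring
    · intro y hy
      rcases Multiset.mem_add.1 hy with hy | hy
      · have := mem_rowsAt.1 hy
        exact ⟨this.2.1, by omega, by omega⟩
      · have := mem_rowsAt.1 hy
        exact ⟨this.2.1, by omega, fun _ => (Multiset.mem_filter.1 this.2.2).2⟩
    · simp [startOrigin]
    · simp [startOrigin]

/-- The labels on the top level `j` are inserted in decreasing order, so the induction lowers the
threshold `D` from `C`. -/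
theorem pathSum_rowsAt_above (hq : ∀ n, qNat q (n + 1) ≠ 0) {s j : ℤ} (hj : s ≤ j) (p : Origin)
    (hp : p.level < j) (hpf : p.final = true) (N : Multiset Row)
    (hN : ∀ y ∈ N, y.2.2 = false ∧ s ≤ y.1 ∧ y.1 < j) (E : Multiset ℕ) (C : ℕ) :
    ∀ d D, D + d = C → pathSum q s p (N + rowsAt j ((E.filter (· < C)).filter (D ≤ ·)))
      = (∏ c ∈ Finset.Ico D C, qComplete q ((E.filter (· < C)).count c)
          ((N.countP fun y => Attacks (j, c, false) y) + (E.filter (· < C)).countP (c < ·)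
            + if Follows p (j, c, false) then 1 else 0))
        * pathSum q s p N := by
  generalize hF : E.filter (· < C) = F
  have hFC : ∀ c ∈ F, c < C := fun c hc => by
    rw [← hF] at hc; exact (Multiset.mem_filter.1 hc).2
  intro d
  induction d with
  | zero =>
    rintro D rfl
    have : F.filter (D ≤ ·) = 0 :=
      Multiset.filter_eq_nil.2 fun c hc => not_le.2 (hFC c hc)
    simp [this, rowsAt]
  | succ d ih =>
    intro D hD
    rw [filter_ge, rowsAt_add, rowsAt_replicate, ← add_assoc,
      pathSum_insert_above s hq hj D _ _ _ _ rfl, ih (D + 1) (by omega),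
      Finset.prod_eq_prod_Ico_succ_bot (show D < C by omega)]
    · have : ((N + rowsAt j (F.filter (D + 1 ≤ ·))).countP fun y => Attacks (j, D, false) y)
          = (N.countP fun y => Attacks (j, D, false) y) + F.countP (D < ·) := by
        rw [Multiset.countP_add, countP_rowsAt, Multiset.countP_filter]
        congr 1
        refine Multiset.countP_congr rfl fun c _ => ?_
        simp [Attacks]
      rw [this]
      ring
    · intro y hy
      rcases Multiset.mem_add.1 hy with hy | hy
      · have := hN y hy
        exact ⟨this.1, by omega, by omega⟩
      · have := mem_rowsAt.1 hy
        have h2 := (Multiset.mem_filter.1 this.2.2).2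
        exact ⟨this.2.1, by omega, fun _ => by omega⟩
    · intro y hy _
      rcases Multiset.mem_add.1 hy with hy | hy
      · exact (hN y hy).2.1
      · have := mem_rowsAt.1 hy
        omega
    · omega
    · omega
    · exact fun _ => hpf

/-- `R` plays the role of the labels one diagonal lower, with the start counted among them when it
admits the new row. -/
theorem pathSum_rowsAt_above' (hq : ∀ n, qNat q (n + 1) ≠ 0) {s j : ℤ} (hj : s ≤ j) (p : Origin)
    (hp : p.level < j) (hpf : p.final = true) (N : Multiset Row)
    (hN : ∀ y ∈ N, y.2.2 = false ∧ s ≤ y.1 ∧ y.1 < j) {R E : Multiset ℕ} {C : ℕ}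
    (hE : ∀ e ∈ E, e < C)
    (hR : ∀ c, (N.countP fun y => Attacks (j, c, false) y)
      + (if Follows p (j, c, false) then 1 else 0) = R.countP (· < c)) :
    pathSum q s p (N + rowsAt j E)
      = (∏ c ∈ Finset.range C, qComplete q (E.count c) (crossing R E c)) * pathSum q s p N := by
  have h := pathSum_rowsAt_above hq hj p hp hpf N hN E C C 0 (zero_add C)
  have h1 : E.filter (· < C) = E := Multiset.filter_eq_self.2 hE
  have h2 : E.filter (0 ≤ ·) = E := Multiset.filter_eq_self.2 fun c _ => Nat.zero_le c
  rw [h1, h2] at h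
  rw [h, Finset.range_eq_Ico]
  congr 1
  refine Finset.prod_congr rfl fun c _ => ?_
  rw [crossing, ← hR c]
  congr 1
  omega

theorem pathSum_rowsAt_start (hq : ∀ n, qNat q (n + 1) ≠ 0) (s : ℤ) {E : Multiset ℕ} {C : ℕ}
    (hE : ∀ e ∈ E, e < C) :
    pathSum q s (startOrigin s) (rowsAt s E)
      = ∏ c ∈ Finset.range C, qComplete q (E.count c) (crossing {0} E c) := by
  -- The start acts as a phantom row labelled `0` just below the main diagonal, hence `R = {0}`.
  have h := pathSum_rowsAt_above' hq (le_refl s) (startOrigin s) (by simp [startOrigin]) rfl 0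
    (by simp) (R := {0}) hE (by
      intro c
      simp [Follows, startOrigin, Multiset.countP_eq_card_filter, Multiset.filter_singleton]
      split_ifs <;> simp)
  rw [zero_add] at h
  rw [h, pathSum_zero]
  simp [startOrigin]

/-- For the shift `s`, `E` lies on the main diagonal and `R` is inserted below it; for `s - 1`, `R`
lies on the main diagonal and `E` is inserted above it. `two_level_identity` compares the resulting
products. -/
theorem pathSum_two_levels (hq : ∀ n, qNat q (n + 1) ≠ 0) (s : ℤ) (R E : Multiset ℕ) :
    qNat q (R.countP (0 < ·)) * pathSum q s (startOrigin s) (rowsAt s E + rowsAt (s - 1) R)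
      = qNat q (E.countP (0 < ·)) *
        pathSum q (s - 1) (startOrigin (s - 1)) (rowsAt s E + rowsAt (s - 1) R) := by
  obtain ⟨C, hC⟩ : ∃ C, ∀ c ∈ R + E, c < C := by
    refine ⟨(R + E).sum + 1, fun c hc => Nat.lt_succ_of_le (Multiset.le_sum_of_mem hc)⟩
  have hR : ∀ c ∈ R, c < C := fun c hc => hC c (Multiset.mem_add.2 (Or.inl hc))
  have hE : ∀ c ∈ E, c < C := fun c hc => hC c (Multiset.mem_add.2 (Or.inr hc))
  have h1 := pathSum_rowsAt_below hq s E R C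
  rw [Multiset.filter_eq_self.2 hR, pathSum_rowsAt_start hq s hE] at h1
  have h2 := pathSum_rowsAt_above' hq (s := s - 1) (j := s) (by omega) (startOrigin (s - 1))
    (by simp [startOrigin]) rfl (rowsAt (s - 1) R)
    (fun y hy => by
      have := mem_rowsAt.1 hy
      exact ⟨this.2.1, by omega, by omega⟩) (R := R) hE
    (by
      intro c
      have h : ¬ Follows (startOrigin (s - 1)) (s, c, false) := by
        simp [Follows, startOrigin]
      rw [countP_rowsAt, if_neg h, add_zero]
      refine Multiset.countP_congr rfl fun c _ => ?_
      simp [Attacks]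
      omega)
  rw [pathSum_rowsAt_start hq (s - 1) hR] at h2
  rw [h1, add_comm (rowsAt s E), h2]
  exact two_level_identity hq hR hE

/-- Rows are peeled off from the lowest level (largest label first) and from the highest level
(smallest label first). Outside the window the insertion factors involve only attacks among rows,
hence do not depend on which of the two shifts is used. -/
theorem exists_pathSum_eq_window (hq : ∀ n, qNat q (n + 1) ≠ 0) (s : ℤ) :
    ∀ (n : ℕ) (U : Multiset Row), U.card = n → (∀ y ∈ U, y.2.2 = false) →
      ∃ κ : K, ∀ t, t = s ∨ t = s - 1 → pathSum q t (startOrigin t) U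
        = κ * pathSum q t (startOrigin t) (U.filter fun y => s - 1 ≤ y.1 ∧ y.1 ≤ s) := by
  intro n
  induction n using Nat.strong_induction_on with
  | _ n ih =>
  intro U hn hU
  have step : ∀ (i : ℤ) (c : ℕ), (i, c, false) ∈ U → ¬ (s - 1 ≤ i ∧ i ≤ s) →
      (∃ κ : K, ∀ t, t = s ∨ t = s - 1 → pathSum q t (startOrigin t) U
        = κ * pathSum q t (startOrigin t) (U.filter (· ≠ (i, c, false)))) →
      ∃ κ : K, ∀ t, t = s ∨ t = s - 1 → pathSum q t (startOrigin t) U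
        = κ * pathSum q t (startOrigin t) (U.filter fun y => s - 1 ≤ y.1 ∧ y.1 ≤ s) := by
    rintro i c hx hi ⟨κ, hκ⟩
    obtain ⟨κ', hκ'⟩ := ih _ ((card_filter_ne_lt hx).trans_eq hn)
      (U.filter (· ≠ (i, c, false))) rfl (fun y hy => hU y (Multiset.mem_filter.1 hy).1)
    refine ⟨κ * κ', fun t ht => ?_⟩
    rw [hκ t ht, hκ' t ht, Multiset.filter_filter, mul_assoc]
    congr 3
    refine Multiset.filter_congr fun y _ => ?_
    constructor
    · exact fun h => h.1
    · refine fun h => ⟨h, ?_⟩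
      rintro rfl
      exact hi h
  by_cases hlow : ∃ y ∈ U, y.1 < s - 1
  · obtain ⟨y0, hy0, hlt⟩ := hlow
    obtain ⟨y1, hy1, hmin⟩ := Multiset.exists_min_image (fun y : Row => y.1)
      (s := U) (by rintro rfl; simp at hy0)
    obtain ⟨⟨i, c, m⟩, hx, hmax⟩ := Multiset.exists_max_image (fun y : Row => y.2.1)
      (s := U.filter fun y => y.1 = y1.1) (by
        intro h
        have : y1 ∈ U.filter fun y => y.1 = y1.1 := Multiset.mem_filter.2 ⟨hy1, rfl⟩
        rw [h] at this
        simp at this)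
    obtain ⟨hx, hi⟩ := Multiset.mem_filter.1 hx
    obtain rfl : m = false := hU _ hx
    have hi : i = y1.1 := hi
    have hi0 : i < s - 1 := by have := hmin y0 hy0; omega
    refine step i c hx (by omega) ⟨qComplete q (U.count (i, c, false))
      ((U.filter (· ≠ (i, c, false))).countP fun y => Attacks y (i, c, false)), fun t ht => ?_⟩
    · have e := filter_ne_add_replicate U (i, c, false)
      conv_lhs => rw [← e]
      refine pathSum_insert_below t hq (by omega) c _ _ _ _ rfl ?_ ?_ ?_
      · intro y hy
        obtain ⟨hy, hne⟩ := Multiset.mem_filter.1 hy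
        refine ⟨hU y hy, by have := hmin y hy; omega, fun h => ?_⟩
        have h1 := hmax y (Multiset.mem_filter.2 ⟨hy, by omega⟩)
        refine lt_of_le_of_ne h1 fun h2 => hne ?_
        exact Prod.ext h (Prod.ext h2 (hU y hy))
      · simp only [startOrigin]; omega
      · simp [startOrigin]
  by_cases hhigh : ∃ y ∈ U, s < y.1
  · obtain ⟨y0, hy0, hlt⟩ := hhigh
    obtain ⟨y1, hy1, hmin⟩ := Multiset.exists_max_image (fun y : Row => y.1)
      (s := U) (by rintro rfl; simp at hy0)
    obtain ⟨⟨i, c, m⟩, hx, hmax⟩ := Multiset.exists_min_image (fun y : Row => y.2.1)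
      (s := U.filter fun y => y.1 = y1.1) (by
        intro h
        have : y1 ∈ U.filter fun y => y.1 = y1.1 := Multiset.mem_filter.2 ⟨hy1, rfl⟩
        rw [h] at this
        simp at this)
    obtain ⟨hx, hi⟩ := Multiset.mem_filter.1 hx
    obtain rfl : m = false := hU _ hx
    have hi : i = y1.1 := hi
    have hi0 : s < i := by have := hmin y0 hy0; omega
    refine step i c hx (by omega) ⟨qComplete q (U.count (i, c, false))
      ((U.filter (· ≠ (i, c, false))).countP fun y => Attacks (i, c, false) y), fun t ht => ?_⟩
    · have e := filter_ne_add_replicate U (i, c, false)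
      have hnf : ¬ Follows (startOrigin t) (i, c, false) := by
        simp only [Follows, startOrigin]; omega
      conv_lhs => rw [← e]
      rw [pathSum_insert_above t hq (by omega) c _ _ _ _ rfl, if_neg hnf, add_zero]
      · intro y hy
        obtain ⟨hy, hne⟩ := Multiset.mem_filter.1 hy
        refine ⟨hU y hy, by have := hmin y hy; omega, fun h => ?_⟩
        have h1 := hmax y (Multiset.mem_filter.2 ⟨hy, by omega⟩)
        refine lt_of_le_of_ne h1 fun h2 => hne ?_
        exact Prod.ext h (Prod.ext h2.symm (hU y hy))
      · intro y _ h
        simp only [Follows, rowOrigin] at h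
        omega
      · simp only [startOrigin]; omega
      · simp only [startOrigin]; omega
      · exact fun _ => rfl
  · push Not at hlow hhigh
    refine ⟨1, fun t _ => ?_⟩
    rw [Multiset.filter_eq_self.2 fun y hy => ⟨hlow y hy, hhigh y hy⟩, one_mul]

/-- The number of undecorated positive labels on the diagonal `i`. -/
def numPos (M : Multiset Row) (i : ℤ) : ℕ :=
  M.countP fun y => y.1 = i ∧ y.2.2 = false ∧ 0 < y.2.1

theorem filter_eq_rowsAt {U : Multiset Row} (hU : ∀ y ∈ U, y.2.2 = false) (i : ℤ) :
    U.filter (fun y => y.1 = i) = rowsAt i ((U.filter fun y => y.1 = i).map fun y => y.2.1) := by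
  rw [rowsAt, Multiset.map_map]
  conv_lhs => rw [← Multiset.map_id (U.filter fun y => y.1 = i)]
  refine Multiset.map_congr rfl fun y hy => ?_
  obtain ⟨hy, h⟩ := Multiset.mem_filter.1 hy
  exact Prod.ext h (Prod.ext rfl (hU y hy))

theorem countP_map_filter {U : Multiset Row} (hU : ∀ y ∈ U, y.2.2 = false) (i : ℤ) :
    ((U.filter fun y => y.1 = i).map fun y => y.2.1).countP (0 < ·) = numPos U i := by
  rw [Multiset.countP_map, ← Multiset.countP_eq_card_filter, Multiset.countP_filter, numPos]
  refine Multiset.countP_congr rfl fun y hy => ?_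
  have := hU y hy
  simp [this, and_comm]

theorem pathSum_unmarked (hq : ∀ n, qNat q (n + 1) ≠ 0) (s : ℤ) {U : Multiset Row}
    (hU : ∀ y ∈ U, y.2.2 = false) :
    qNat q (numPos U (s - 1)) * pathSum q s (startOrigin s) U
      = qNat q (numPos U s) * pathSum q (s - 1) (startOrigin (s - 1)) U := by
  obtain ⟨κ, hκ⟩ := exists_pathSum_eq_window hq s _ U rfl hU
  have hw : U.filter (fun y => s - 1 ≤ y.1 ∧ y.1 ≤ s)
      = U.filter (fun y => y.1 = s) + U.filter (fun y => y.1 = s - 1) := by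
    have h := Multiset.filter_add_filter (fun y : Row => y.1 = s) (fun y => y.1 = s - 1) U
    have h0 : U.filter (fun y => y.1 = s ∧ y.1 = s - 1) = 0 :=
      Multiset.filter_eq_nil.2 fun y _ => by omega
    rw [h0, add_zero] at h
    rw [h]
    exact Multiset.filter_congr fun y _ => by omega
  have h := pathSum_two_levels hq s ((U.filter fun y => y.1 = s - 1).map fun y => y.2.1)
    ((U.filter fun y => y.1 = s).map fun y => y.2.1)
  rw [← filter_eq_rowsAt hU, ← filter_eq_rowsAt hU, countP_map_filter hU, countP_map_filter hU,
    ← hw] at h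
  rw [hκ s (Or.inl rfl), hκ (s - 1) (Or.inr rfl)]
  linear_combination κ * h

/-! ### Decorated rows and the bonus -/

/-- The number of positive labels below the main diagonal, for a path of shift `s`. -/
def bonus (s : ℤ) (M : Multiset Row) : ℕ := M.countP fun y => y.1 < s ∧ 0 < y.2.1

theorem bonus_add (s : ℤ) (M N : Multiset Row) : bonus s (M + N) = bonus s M + bonus s N :=
  Multiset.countP_add _ _ _

/-- For positive labels the bonus below the main diagonal supplies the `q ^ r` that insertion
already gives on or above it, so the factor is insensitive to the shift. Zeros receive no bonus, and
their factor also depends on whether the start admits them. -/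
theorem pathSum_insert_marked_start (hq : ∀ n, qNat q (n + 1) ≠ 0) (t i : ℤ) (c r : ℕ)
    {M : Multiset Row} (hx : (i, c, true) ∉ M) :
    q ^ bonus t (Multiset.replicate r (i, c, true)) *
        pathSum q t (startOrigin t) (M + Multiset.replicate r (i, c, true))
      = (if 0 < c ∨ t ≤ i then q ^ r * qElem q r (M.countP fun y => Attacks y (i, c, true))
          else if i < t - 1 then qElem q r (M.countP fun y => Attacks y (i, c, true))
          else q ^ r * qElem q r ((M.countP fun y => Attacks y (i, c, true)) - 1))
        * pathSum q t (startOrigin t) M := by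
  rw [pathSum_insert_marked t hq i c _ r M (startOrigin t) rfl hx (fun _ _ => rfl) _ rfl,
    bonus, countP_replicate_row, ← mul_assoc]
  congr 1
  have hf : Follows (startOrigin t) (i, c, true) ↔ i < t - 1 ∨ (i = t - 1 ∧ 0 < c) := by
    simp only [Follows, startOrigin]
    simp
    omega
  simp only [hf]
  rcases Nat.eq_zero_or_pos c with rfl | hc
  · rcases lt_or_ge i t with h1 | h1
    · simp [not_le.2 h1]
    · have : ¬ i < t - 1 := by omega
      simp [h1, this]
  · rcases lt_or_ge i t with h1 | h1
    · have : i < t - 1 ∨ i = t - 1 := by omega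
      simp [hc, h1, not_le.2 h1, this]
    · have h2 : ¬ i < t - 1 := by omega
      have h3 : ¬ i = t - 1 := by omega
      have h4 : ¬ i < t := by omega
      simp [hc, h1, h2, h3, h4]

/-- Passing from `s` to `s - 1` changes the case in `pathSum_insert_marked_start` only for zeros on
the levels `s - 1` and `s - 2`. Decorated rows can be inserted in any order. -/
theorem exists_pathSum_marked (hq : ∀ n, qNat q (n + 1) ≠ 0) (s : ℤ) (U : Multiset Row)
    (hU : ∀ y ∈ U, y.2.2 = false) :
    ∀ (n : ℕ) (D : Multiset Row), D.card = n →
      (∀ y ∈ D, y.2.2 = true ∧ y ≠ (s - 1, 0, true) ∧ y ≠ (s - 2, 0, true)) →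
      ∃ κ : K, ∀ t, t = s ∨ t = s - 1 →
        q ^ bonus t D * pathSum q t (startOrigin t) (U + D)
          = κ * pathSum q t (startOrigin t) U := by
  intro n
  induction n using Nat.strong_induction_on with
  | _ n ih =>
  intro D hn hD
  rcases eq_or_ne D 0 with rfl | hD0
  · exact ⟨1, fun t _ => by simp [bonus]⟩
  · obtain ⟨⟨i, c, m⟩, hx⟩ := Multiset.exists_mem_of_ne_zero hD0
    have hD' := hD _ hx
    obtain rfl : m = true := hD'.1
    obtain ⟨κ, hκ⟩ := ih _ ((card_filter_ne_lt hx).trans_eq hn)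
      (D.filter (· ≠ (i, c, true))) rfl (fun y hy => hD y (Multiset.mem_filter.1 hy).1)
    have hx' : (i, c, true) ∉ U + D.filter (· ≠ (i, c, true)) := by
      rw [Multiset.mem_add, not_or]
      exact ⟨fun h => by simpa using hU _ h, by simp⟩
    have e := filter_ne_add_replicate D (i, c, true)
    generalize D.filter (· ≠ (i, c, true)) = D₁ at *
    generalize D.count (i, c, true) = r at *
    refine ⟨(if 0 < c ∨ s ≤ i then
        q ^ r * qElem q r ((U + D₁).countP fun y => Attacks y (i, c, true))
      else qElem q r ((U + D₁).countP fun y => Attacks y (i, c, true))) * κ, fun t ht => ?_⟩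
    have h1 := pathSum_insert_marked_start hq t i c r hx'
    rw [← e, bonus_add, ← add_assoc, pow_add, mul_assoc, h1, mul_left_comm, hκ t ht, mul_assoc]
    congr 1
    have hi : 0 < c ∨ (i ≠ s - 1 ∧ i ≠ s - 2) := by
      rcases Nat.eq_zero_or_pos c with rfl | hc
      · exact Or.inr ⟨fun h => hD'.2.1 (by rw [h]), fun h => hD'.2.2 (by rw [h])⟩
      · exact Or.inl hc
    rcases hi with hc | ⟨h2, h3⟩
    · simp [hc]
    · by_cases hc : 0 < c ∨ s ≤ i
      · have : 0 < c ∨ t ≤ i := by omega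
        rw [if_pos hc, if_pos this]
      · have h4 : ¬ (0 < c ∨ t ≤ i) := by omega
        have h5 : i < t - 1 := by omega
        rw [if_neg hc, if_neg h4, if_pos h5]

theorem qNat_eq_div (hq1 : q ≠ 1) (n : ℕ) : (1 - q ^ (n : ℤ)) / (1 - q) = qNat q n := by
  rw [qNat, geom_sum_eq hq1, zpow_natCast, ← neg_sub, ← neg_sub q 1, neg_div_neg_eq]

theorem qInt_sub_mul_qElem (hq1 : q ≠ 1) (r w : ℕ) :
    (1 - q ^ ((w : ℤ) - r)) / (1 - q) * qElem q r w = qNat q w * qElem q r (w - 1) := by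
  rcases lt_or_ge w r with h | h
  · rw [qElem_eq_zero h, qElem_eq_zero (by omega : w - 1 < r)]
    simp
  · rw [← Nat.cast_sub h, qNat_eq_div hq1, qNat_sub_mul_qElem]

theorem bonus_replicate_zero (t i : ℤ) (r : ℕ) (m : Bool) :
    bonus t (Multiset.replicate r (i, 0, m)) = 0 := by
  simp [bonus, countP_replicate_row]

theorem bonus_eq_add_numPos (s : ℤ) {U : Multiset Row} (hU : ∀ y ∈ U, y.2.2 = false) :
    bonus s U = bonus (s - 1) U + numPos U (s - 1) := by
  induction U using Multiset.induction with
  | empty => simp [bonus, numPos]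
  | cons y U ih =>
    have ih := ih fun w hw => hU w (Multiset.mem_cons_of_mem hw)
    have hy := hU y (Multiset.mem_cons_self y U)
    simp only [bonus, numPos, Multiset.countP_cons, hy, true_and] at ih ⊢
    rw [ih]
    split_ifs <;> omega

/-- The exceptional marked zeros are inserted last. Decorated rows attack nothing, so a marked zero
on level `i` is attacked exactly by the undecorated positive labels on level `i + 1`; this is how
the two `q`-integers acquire their corrections. -/
theorem pathSum_ratio (hq : ∀ n, qNat q (n + 1) ≠ 0) (hq0 : q ≠ 0) (hq1 : q ≠ 1) (s : ℤ)
    (M : Multiset Row) (num den : ℤ)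
    (hnum : num = (numPos M s : ℤ) - (M.count (s - 1, 0, true) : ℤ))
    (hden : den = (numPos M (s - 1) : ℤ) - (M.count (s - 2, 0, true) : ℤ)) :
    (1 - q ^ den) / (1 - q) * (q ^ bonus s M * pathSum q s (startOrigin s) M)
      = q ^ den * ((1 - q ^ num) / (1 - q)) *
        (q ^ bonus (s - 1) M * pathSum q (s - 1) (startOrigin (s - 1)) M) := by
  obtain ⟨U, hUdef⟩ : ∃ U, U = M.filter fun y => y.2.2 = false := ⟨_, rfl⟩
  obtain ⟨D, hDdef⟩ : ∃ D, D = M.filter fun y =>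
    y.2.2 = true ∧ y ≠ (s - 1, 0, true) ∧ y ≠ (s - 2, 0, true) := ⟨_, rfl⟩
  obtain ⟨a, ha⟩ : ∃ a, a = M.count (s - 1, 0, true) := ⟨_, rfl⟩
  obtain ⟨b, hb⟩ : ∃ b, b = M.count (s - 2, 0, true) := ⟨_, rfl⟩
  have hU : ∀ y ∈ U, y.2.2 = false := fun y hy => by
    rw [hUdef] at hy; exact (Multiset.mem_filter.1 hy).2
  have hD : ∀ y ∈ D, y.2.2 = true ∧ y ≠ (s - 1, 0, true) ∧ y ≠ (s - 2, 0, true) := fun y hy => by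
    rw [hDdef] at hy; exact (Multiset.mem_filter.1 hy).2
  have hne : ((s - 1, 0, true) : Row) ≠ (s - 2, 0, true) := by
    intro h
    have := congrArg Prod.fst h
    simp only at this
    omega
  have hM : M = U + D + Multiset.replicate a (s - 1, 0, true)
      + Multiset.replicate b (s - 2, 0, true) := by
    ext y
    rw [Multiset.count_add, Multiset.count_add, Multiset.count_add, Multiset.count_replicate,
      Multiset.count_replicate, hUdef, hDdef, Multiset.count_filter, Multiset.count_filter, ha, hb]
    by_cases h1 : y = (s - 1, 0, true)
    · subst h1
      simp [hne.symm]
    · by_cases h2 : y = (s - 2, 0, true)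
      · subst h2
        simp [hne]
      · cases hm : y.2.2 <;> simp [h1, h2, Ne.symm h1, Ne.symm h2]
  have hx1 : (s - 1, 0, true) ∉ U + D := by
    rw [Multiset.mem_add, not_or]
    exact ⟨fun h => by simpa using hU _ h, fun h => (hD _ h).2.1 rfl⟩
  have hx2 : (s - 2, 0, true) ∉ U + D + Multiset.replicate a (s - 1, 0, true) := by
    rw [Multiset.mem_add, Multiset.mem_add, not_or, not_or]
    exact ⟨⟨fun h => by simpa using hU _ h, fun h => (hD _ h).2.2 rfl⟩,
      fun h => hne (Multiset.eq_of_mem_replicate h).symm⟩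
  have hDP : ∀ i, numPos D i = 0 := fun i =>
    Multiset.countP_eq_zero.2 fun y hy h => by simp [(hD y hy).1] at h
  have hrP : ∀ i j r, numPos (Multiset.replicate r (j, 0, true)) i = 0 := fun i j r => by
    simp [numPos, countP_replicate_row]
  have hnumPos : ∀ i, numPos M i = numPos U i := by
    intro i
    have hadd : ∀ A B, numPos (A + B) i = numPos A i + numPos B i :=
      fun A B => Multiset.countP_add _ _ _
    rw [hM, hadd, hadd, hadd, hDP, hrP, hrP]
    rfl
  have hatt : ∀ i (N : Multiset Row),
      (N.countP fun y => Attacks y (i, 0, true)) = numPos N (i + 1) := by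
    intro i N
    refine Multiset.countP_congr rfl fun y _ => ?_
    simp only [Attacks]
    simp
    tauto
  have hatt1 : ((U + D).countP fun y => Attacks y (s - 1, 0, true)) = numPos U s := by
    rw [hatt, sub_add_cancel]
    have : numPos (U + D) s = numPos U s + numPos D s := Multiset.countP_add _ _ _
    rw [this, hDP, add_zero]
  have hatt2 : ((U + D + Multiset.replicate a (s - 1, 0, true)).countP
      fun y => Attacks y (s - 2, 0, true)) = numPos U (s - 1) := by
    rw [hatt, show s - 2 + 1 = s - 1 by ring]
    have hadd : ∀ A B, numPos (A + B) (s - 1) = numPos A (s - 1) + numPos B (s - 1) :=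
      fun A B => Multiset.countP_add _ _ _
    rw [hadd, hadd, hDP, hrP]
    rfl
  have hbonus : ∀ t, bonus t M = bonus t U + bonus t D := by
    intro t
    rw [hM, bonus_add, bonus_add, bonus_add, bonus_replicate_zero, bonus_replicate_zero]
    rfl
  obtain ⟨κ, hκ⟩ := exists_pathSum_marked hq s U hU _ D rfl hD
  have e1 := pathSum_insert_marked_start hq s (s - 1) 0 a hx1
  have e2 := pathSum_insert_marked_start hq s (s - 2) 0 b hx2
  have e3 := pathSum_insert_marked_start hq (s - 1) (s - 1) 0 a hx1
  have e4 := pathSum_insert_marked_start hq (s - 1) (s - 2) 0 b hx2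
  -- The zeros on level `s - 1` are just below the main diagonal for the shift `s` and on it for `s
  -- - 1`; those on level `s - 2` are two below it, respectively just below it.
  rw [bonus_replicate_zero, pow_zero, one_mul, hatt1, if_neg (by omega), if_neg (by omega)] at e1
  rw [bonus_replicate_zero, pow_zero, one_mul, hatt2, if_neg (by omega), if_pos (by omega)] at e2
  rw [bonus_replicate_zero, pow_zero, one_mul, hatt1, if_pos (by omega)] at e3
  rw [bonus_replicate_zero, pow_zero, one_mul, hatt2, if_neg (by omega), if_neg (by omega)] at e4
  rw [e1, ← hM] at e2
  rw [e3, ← hM] at e4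
  have k1 := hκ s (Or.inl rfl)
  have k2 := hκ (s - 1) (Or.inr rfl)
  have hun := pathSum_unmarked hq s hU
  have hE := qInt_sub_mul_qElem hq1 a (numPos U s)
  have hP := qInt_sub_mul_qElem hq1 b (numPos U (s - 1))
  rw [hnumPos, ← ha] at hnum
  rw [hnumPos, ← hb] at hden
  have hpow : q ^ numPos U (s - 1) = q ^ den * q ^ b := by
    rw [← zpow_natCast, ← zpow_natCast, ← zpow_add₀ hq0, hden]
    congr 1
    ring
  rw [← hnum] at hE
  rw [← hden] at hP
  rw [e2, e4, hbonus, hbonus, bonus_eq_add_numPos s hU]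
  generalize pathSum q s (startOrigin s) (U + D) = A at *
  generalize pathSum q (s - 1) (startOrigin (s - 1)) (U + D) = B at *
  generalize pathSum q s (startOrigin s) U = A' at *
  generalize pathSum q (s - 1) (startOrigin (s - 1)) U = B' at *
  rw [pow_add, pow_add, pow_add, hpow]
  generalize (1 - q ^ den) / (1 - q) = X at *
  generalize (1 - q ^ num) / (1 - q) = Y at *
  generalize q ^ den = Q at *
  generalize q ^ bonus s D = β at *
  generalize q ^ bonus (s - 1) D = β' at *
  generalize q ^ bonus (s - 1) U = γ at *
  generalize qElem q b (numPos U (s - 1) - 1) = f1 at *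
  generalize qElem q b (numPos U (s - 1)) = f at *
  generalize qElem q a (numPos U s - 1) = g1 at *
  generalize qElem q a (numPos U s) = g at *
  generalize qNat q (numPos U s) = nE at *
  generalize qNat q (numPos U (s - 1)) = nP at *
  generalize q ^ a = qa at *
  generalize q ^ b = qb at *
  linear_combination (X * γ * Q * qb * f * qa * g1) * k1 + (γ * Q * qb * qa * g1 * κ * A') * hP
    + (γ * Q * qb * qa * g1 * f1 * κ) * hun - (γ * Q * qb * qa * f1 * κ * B') * hE
    - (Q * Y * γ * qb * f1 * qa * g) * k2

end Ratio

/-! ### Lattice paths and their area words -/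

section AreaWords

/-- The list is the area word of a lattice path that starts on `y = x + h` and ends, with an east
step, on `y = x + e`. -/
def IsAreaWord : ℤ → ℤ → List ℤ → Prop
  | h, e, [] => e < h
  | h, e, b :: w => b ≤ h ∧ IsAreaWord (b + 1) e w

/-- The steps of the lattice path from `y = x + h` to `y = x + e` with a given area word. -/
def stepsOf : ℤ → ℤ → List ℤ → List Step
  | h, e, [] => List.replicate (h - e).toNat Step.east
  | h, e, b :: w => List.replicate (h - b).toNat Step.east ++ Step.north :: stepsOf (b + 1) e w

theorem IsAreaWord.mono {h h' e : ℤ} (hh : h ≤ h') {w : List ℤ} (hw : IsAreaWord h e w) :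
    IsAreaWord h' e w := by
  cases w with
  | nil => exact lt_of_lt_of_le hw hh
  | cons b w => exact ⟨hw.1.trans hh, hw.2⟩

theorem height_cons_north (l : List Step) : height (Step.north :: l) = height l + 1 := by
  simp [height]; ring

theorem height_cons_east (l : List Step) : height (Step.east :: l) = height l - 1 := by
  simp [height]; ring

theorem isAreaWord_areaWordFrom (l : List Step) (h : ℤ) (hl : l.getLast? = some Step.east) :
    IsAreaWord h (h + height l) (areaWordFrom h l) := by
  induction l generalizing h with
  | nil => simp at hl
  | cons d l ih =>
    rcases eq_or_ne l [] with rfl | hl0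
    · have : d = Step.east := by simpa using hl
      subst this
      simp [areaWordFrom, IsAreaWord, height]
    · have hl' : l.getLast? = some Step.east := by
        rw [← hl, List.getLast?_cons_of_ne_nil hl0]
      cases d with
      | north =>
        refine ⟨le_rfl, ?_⟩
        have := ih (h + 1) hl'
        rwa [height_cons_north, ← add_assoc, add_right_comm]
      | east =>
        have := ih (h - 1) hl'
        rw [height_cons_east, show h + (height l - 1) = h - 1 + height l by ring]
        exact this.mono (by omega)

theorem stepsOf_pred {h e : ℤ} {w : List ℤ} (hw : IsAreaWord (h - 1) e w) :
    stepsOf h e w = Step.east :: stepsOf (h - 1) e w := by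
  cases w with
  | nil =>
    have hw : e < h - 1 := hw
    have : (h - e).toNat = (h - 1 - e).toNat + 1 := by omega
    simp only [stepsOf]
    rw [this, List.replicate_succ]
  | cons b w =>
    have hw := hw.1
    have : (h - b).toNat = (h - 1 - b).toNat + 1 := by omega
    simp only [stepsOf]
    rw [this, List.replicate_succ, List.cons_append]

theorem stepsOf_areaWordFrom (l : List Step) (h : ℤ) (hl : l.getLast? = some Step.east) :
    stepsOf h (h + height l) (areaWordFrom h l) = l := by
  induction l generalizing h with
  | nil => simp at hl
  | cons d l ih =>
    rcases eq_or_ne l [] with rfl | hl0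
    · have : d = Step.east := by simpa using hl
      subst this
      simp [areaWordFrom, stepsOf, height]
    · have hl' : l.getLast? = some Step.east := by
        rw [← hl, List.getLast?_cons_of_ne_nil hl0]
      cases d with
      | north =>
        have := ih (h + 1) hl'
        simp only [areaWordFrom, stepsOf]
        rw [height_cons_north, show h + (height l + 1) = h + 1 + height l by ring, this]
        simp
      | east =>
        have h1 := isAreaWord_areaWordFrom l (h - 1) hl'
        have := ih (h - 1) hl'
        simp only [areaWordFrom]
        rw [height_cons_east, show h + (height l - 1) = h - 1 + height l by ring,
          stepsOf_pred h1, this]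

theorem areaWordFrom_replicate_east (n : ℕ) (l : List Step) (h : ℤ) :
    areaWordFrom h (List.replicate n Step.east ++ l) = areaWordFrom (h - n) l := by
  induction n generalizing h with
  | zero => simp
  | succ n ih =>
    rw [List.replicate_succ, List.cons_append, areaWordFrom, ih]
    congr 1
    push_cast
    ring

theorem height_append (l l' : List Step) : height (l ++ l') = height l + height l' := by
  simp [height]; ring

theorem height_replicate_east (n : ℕ) : height (List.replicate n Step.east) = -n := by
  simp [height, List.count_replicate]

theorem stepsOf_spec (w : List ℤ) (h e : ℤ) (hw : IsAreaWord h e w) :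
    areaWordFrom h (stepsOf h e w) = w ∧ height (stepsOf h e w) = e - h ∧
      (stepsOf h e w).getLast? = some Step.east := by
  induction w generalizing h with
  | nil =>
    have hw : e < h := hw
    obtain ⟨n, hn⟩ : ∃ n : ℕ, h - e = n + 1 := ⟨(h - e - 1).toNat, by omega⟩
    have hn' : (h - e).toNat = n + 1 := by omega
    simp only [stepsOf, hn']
    refine ⟨?_, ?_, ?_⟩
    · have := areaWordFrom_replicate_east (n + 1) [] h
      rw [List.append_nil] at this
      rw [this]
      rfl
    · rw [height_replicate_east]; push_cast; omega
    · simp [List.getLast?_replicate]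
  | cons b w ih =>
    obtain ⟨h1, h2⟩ := hw
    obtain ⟨i1, i2, i3⟩ := ih (b + 1) h2
    simp only [stepsOf]
    refine ⟨?_, ?_, ?_⟩
    · rw [areaWordFrom_replicate_east, Int.toNat_of_nonneg (by omega), sub_sub_cancel,
        areaWordFrom, i1]
    · rw [height_append, height_replicate_east, height_cons_north, i2]
      omega
    · rw [List.getLast?_append, List.getLast?_cons, i3]
      simp

/-- Between north steps the path only descends, so its minimal height is attained where a north step
starts or at the end. -/
theorem height_take_ge (l : List Step) (h : ℤ) (s : ℤ) (h1 : ∀ x ∈ areaWordFrom h l, s ≤ x)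
    (h2 : s ≤ h + height l) (j : ℕ) : s ≤ h + height (l.take j) := by
  induction l generalizing h j with
  | nil => simpa using h2
  | cons d l ih =>
    cases d with
    | north =>
      cases j with
      | zero =>
        have := h1 h (by simp [areaWordFrom])
        simpa [height] using this
      | succ j =>
        have := ih (h + 1) (fun x hx => h1 x (by simp [areaWordFrom, hx]))
          (by rw [height_cons_north] at h2; omega) j
        rw [List.take_succ_cons, height_cons_north]
        omega
    | east =>
      have ih := ih (h - 1) (fun x hx => h1 x (by simpa [areaWordFrom] using hx))
          (by rw [height_cons_east] at h2; omega)
      cases j with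
      | zero =>
        have := ih 0
        simp [height] at this ⊢
        omega
      | succ j =>
        have := ih j
        rw [List.take_succ_cons, height_cons_east]
        omega

/-- The condition on the last letter is `e ≤ a i` because the height after that north step is `a i +
1` and an east step must still follow. -/
theorem isAreaWord_ofFn {N : ℕ} (h e : ℤ) (a : Fin N → ℤ) :
    IsAreaWord h e (List.ofFn a) ↔ (N = 0 → e < h) ∧ (∀ i : Fin N, (i : ℕ) = 0 → a i ≤ h) ∧
      (∀ i j : Fin N, (j : ℕ) = i + 1 → a j ≤ a i + 1) ∧
      ∀ i : Fin N, (i : ℕ) + 1 = N → e ≤ a i := by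
  induction N generalizing h with
  | zero => simp [IsAreaWord]
  | succ N ih =>
    rw [List.ofFn_succ, IsAreaWord, ih]
    constructor
    · rintro ⟨h1, h2, h3, h4, h5⟩
      refine ⟨by simp, ?_, ?_, ?_⟩
      · intro i hi
        obtain rfl : i = 0 := Fin.ext hi
        exact h1
      · intro i j hij
        obtain ⟨j, rfl⟩ := Fin.exists_succ_eq.2 (show j ≠ 0 by rintro rfl; simp at hij)
        rcases Fin.eq_zero_or_eq_succ i with rfl | ⟨i, rfl⟩
        · exact h3 j (by simpa using hij)
        · exact h4 i j (by simpa using hij)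
      · intro i hi
        rcases Fin.eq_zero_or_eq_succ i with rfl | ⟨i, rfl⟩
        · have := h2 (by simpa using hi.symm)
          omega
        · exact h5 i (by simpa using hi)
    · rintro ⟨-, h2, h3, h4⟩
      refine ⟨h2 0 rfl, ?_, ?_, ?_, ?_⟩
      · intro hN
        have := h4 0 (by simp [hN])
        omega
      · intro i hi
        exact h3 0 i.succ (by simp [hi])
      · intro i j hij
        exact h3 i.succ j.succ (by simp [hij])
      · intro i hi
        exact h4 i.succ (by simp [hi])

theorem isPathFrom_ofFn {N : ℕ} (s : ℤ) (p : Origin) (f : Fin N → Row) :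
    IsPathFrom s p (List.ofFn f) ↔ (N = 0 → p.final = true) ∧
      (∀ i : Fin N, (i : ℕ) = 0 → Follows p (f i)) ∧
      (∀ i j : Fin N, (j : ℕ) = i + 1 → Follows (rowOrigin s (f i)) (f j)) ∧
      ∀ i : Fin N, (i : ℕ) + 1 = N → s ≤ (f i).1 := by
  induction N generalizing p with
  | zero => simp [IsPathFrom]
  | succ N ih =>
    rw [List.ofFn_succ, IsPathFrom, ih]
    constructor
    · rintro ⟨h1, h2, h3, h4, h5⟩
      refine ⟨by simp, ?_, ?_, ?_⟩
      · intro i hi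
        obtain rfl : i = 0 := Fin.ext hi
        exact h1
      · intro i j hij
        obtain ⟨j, rfl⟩ := Fin.exists_succ_eq.2 (show j ≠ 0 by rintro rfl; simp at hij)
        rcases Fin.eq_zero_or_eq_succ i with rfl | ⟨i, rfl⟩
        · exact h3 j (by simpa using hij)
        · exact h4 i j (by simpa using hij)
      · intro i hi
        rcases Fin.eq_zero_or_eq_succ i with rfl | ⟨i, rfl⟩
        · have := h2 (by simpa using hi.symm)
          simpa [rowOrigin] using this
        · exact h5 i (by simpa using hi)
    · rintro ⟨-, h2, h3, h4⟩
      refine ⟨h2 0 rfl, ?_, ?_, ?_, ?_⟩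
      · intro hN
        have := h4 0 (by simp [hN])
        simpa [rowOrigin] using this
      · intro i hi
        exact h3 0 i.succ (by simp [hi])
      · intro i j hij
        exact h3 i.succ j.succ (by simp [hij])
      · intro i hi
        exact h4 i.succ (by simp [hi])

theorem inversions_ofFn {N : ℕ} (f : Fin N → Row) :
    inversions (List.ofFn f)
      = (Finset.univ.filter fun p : Fin N × Fin N => p.1 < p.2 ∧ Attacks (f p.1) (f p.2)).card := by
  rw [Finset.card_filter, Fintype.sum_prod_type]
  induction N with
  | zero => simp [inversions]
  | succ N ih =>
    rw [List.ofFn_succ, inversions, ih, Fin.sum_univ_succ]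
    congr 1
    · rw [Fin.sum_univ_succ]
      have : ∀ {M : ℕ} (g : Fin M → Row), (List.ofFn g).countP (fun x => Attacks (f 0) x)
          = ∑ j, if Attacks (f 0) (g j) then 1 else 0 := by
        intro M g
        induction M with
        | zero => simp
        | succ M ih =>
          rw [List.ofFn_succ, List.countP_cons, ih, Fin.sum_univ_succ, add_comm]
          simp
      rw [this]
      simp
    · refine Finset.sum_congr rfl fun i _ => ?_
      rw [Fin.sum_univ_succ]
      simp

end AreaWords

/-! ### Correspondence between decorated paths and words of rows -/

/-- The marked labels on the diagonal `i`, in increasing order. -/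
def diagonalOf (M : Multiset Row) (i : ℕ) : MarkedWord :=
  ((M.filter fun y : Row => y.1 = (i : ℤ)).map
    fun y : Row => (toLex (y.2.1, y.2.2) : MarkedLetter)).sort (· ≤ ·)

namespace ValleyDecoratedPath

variable {m n k : ℕ}

/-- The row `j` of a path. -/
def row (π : ValleyDecoratedPath m n k) (j : Fin (m + n)) : Row :=
  (π.a j + π.shift, π.label j, decide (j ∈ π.dv))

/-- The rows of a path, from bottom to top. -/
def rowList (π : ValleyDecoratedPath m n k) : List Row := List.ofFn π.row

/-- The rows of a path, regardless of their order. -/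
def rows (π : ValleyDecoratedPath m n k) : Multiset Row :=
  (Finset.univ : Finset (Fin (m + n))).val.map π.row

theorem coe_rowList (π : ValleyDecoratedPath m n k) : (π.rowList : Multiset Row) = π.rows := by
  rw [rowList, rows, Fin.univ_val_map]

theorem areaWordFrom_steps (π : ValleyDecoratedPath m n k) :
    areaWordFrom 0 π.steps = List.ofFn π.a := by
  refine List.ext_getElem ?_ ?_
  · rw [length_areaWordFrom, π.count_north, List.length_ofFn]
  · intro i h1 h2
    rw [List.getElem_ofFn]
    rfl

theorem height_steps (π : ValleyDecoratedPath m n k) : height π.steps = 0 := by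
  rw [height, π.count_north, π.count_east, sub_self]

theorem getLast?_steps (π : ValleyDecoratedPath m n k) (h : 0 < m + n) :
    π.steps.getLast? = some Step.east := by
  have hne : π.steps ≠ [] := by
    intro h0
    have := π.count_north
    rw [h0] at this
    simp at this
    omega
  rw [List.getLast?_eq_some_getLast hne]
  congr 1
  exact π.ends_east _ (List.getLast?_eq_some_getLast hne)

theorem isAreaWord_a (π : ValleyDecoratedPath m n k) (h : 0 < m + n) :
    IsAreaWord 0 0 (List.ofFn π.a) := by
  have := isAreaWord_areaWordFrom π.steps 0 (π.getLast?_steps h)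
  rwa [height_steps, areaWordFrom_steps, add_zero] at this

theorem steps_eq (π : ValleyDecoratedPath m n k) (h : 0 < m + n) :
    π.steps = stepsOf 0 0 (List.ofFn π.a) := by
  have := stepsOf_areaWordFrom π.steps 0 (π.getLast?_steps h)
  rw [height_steps, areaWordFrom_steps, add_zero] at this
  exact this.symm

theorem isPathFrom_rowList (π : ValleyDecoratedPath m n k) (h : 0 < m + n) :
    IsPathFrom π.shift (startOrigin π.shift) π.rowList := by
  obtain ⟨-, a1, a2, a3⟩ := (isAreaWord_ofFn _ _ _).1 (π.isAreaWord_a h)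
  rw [rowList, isPathFrom_ofFn]
  refine ⟨by omega, ?_, ?_, ?_⟩
  · intro i hi
    have h1 := a1 i hi
    have h2 := π.label_first i hi
    refine ⟨?_, ?_, ?_⟩
    · simp only [startOrigin, row]; omega
    · simp only [startOrigin, row]
      intro h
      exact h2 (by omega)
    · simp only [startOrigin, row, decide_eq_true_eq]
      intro hd
      rcases π.dv_valley i hd with ⟨-, h⟩ | ⟨j, hj, -⟩
      · omega
      · omega
  · intro i j hij
    have h1 := a2 i j hij
    have h2 := π.label_lt i j hij
    refine ⟨?_, ?_, ?_⟩
    · simp only [rowOrigin, row]; omega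
    · simp only [rowOrigin, row]
      intro h
      exact h2 (by omega)
    · simp only [rowOrigin, row, decide_eq_true_eq]
      intro hd
      rcases π.dv_valley j hd with ⟨h, -⟩ | ⟨i', hi', h⟩
      · omega
      · obtain rfl : i' = i := Fin.ext (by omega)
        omega
  · intro i hi
    have := a3 i hi
    simp only [row]
    omega

/-- The rows and the shift recover the area word, and a path ending with an east step is recovered
from its area word by `stepsOf`. -/
theorem rowList_injective (h : 0 < m + n) {π π' : ValleyDecoratedPath m n k}
    (hs : π.shift = π'.shift) (hl : π.rowList = π'.rowList) : π = π' := by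
  have hrow : π.row = π'.row := List.ofFn_injective hl
  have ha : π.a = π'.a := by
    funext i
    have := congrArg Prod.fst (congrFun hrow i)
    simp only [row, hs] at this
    exact add_right_cancel this
  have hlab : π.label = π'.label := by
    funext i
    exact congrArg (fun y => y.2.1) (congrFun hrow i)
  have hdv : π.dv = π'.dv := by
    ext i
    have := congrArg (fun y => y.2.2) (congrFun hrow i)
    simpa [row] using this
  have hsteps : π.steps = π'.steps := by
    rw [π.steps_eq h, π'.steps_eq h, ha]
  obtain ⟨⟨⟨_, _, _, _⟩, _, _, _, _⟩, _, _, _, _⟩ := π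
  obtain ⟨⟨⟨_, _, _, _⟩, _, _, _, _⟩, _, _, _, _⟩ := π'
  simp only at hsteps hlab hdv
  subst hsteps hlab hdv
  rfl

end ValleyDecoratedPath

theorem SquarePath.shift_eq {N : ℕ} (π : SquarePath N) (s : ℕ) (h1 : ∀ i, -(s : ℤ) ≤ π.a i)
    (h2 : ∃ i, π.a i = -(s : ℤ)) : π.shift = s := by
  obtain ⟨i, hi⟩ := h2
  have h3 := π.neg_shift_le_a i
  refine le_antisymm (Finset.sup_le fun j _ => ?_) (by omega)
  have h0 : height π.steps = 0 := by rw [height, π.count_north, π.count_east, sub_self]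
  have := height_take_ge π.steps 0 (-s) (fun x hx => ?_) (by rw [h0]; omega) j
  · omega
  · obtain ⟨i, hi, rfl⟩ := List.getElem_of_mem hx
    rw [length_areaWordFrom, π.count_north] at hi
    exact h1 ⟨i, hi⟩

namespace ValleyDecoratedPath

variable {m n k : ℕ}

/-- Surjectivity of the encoding. Nonnegative levels together with a positive label on level `0`
ensure both that the shift is exactly `s` and that the condition on the lowest diagonal holds. -/
theorem exists_rowList_eq (h : 0 < m + n) (s : ℕ) (f : Fin (m + n) → Row)
    (hf : IsPathFrom s (startOrigin s) (List.ofFn f)) (h0 : ∀ i, 0 ≤ (f i).1)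
    (hbase : ∃ i, (f i).1 = 0 ∧ 0 < (f i).2.1)
    (hn : (Finset.univ.filter fun i => 0 < (f i).2.1).card = n)
    (hk : (Finset.univ.filter fun i => (f i).2.2 = true).card = k) :
    ∃ π : ValleyDecoratedPath m n k, π.shift = s ∧ π.row = f := by
  obtain ⟨-, p1, p2, p3⟩ := (isPathFrom_ofFn _ _ _).1 hf
  have hw : IsAreaWord 0 0 (List.ofFn fun i => (f i).1 - s) := by
    rw [isAreaWord_ofFn]
    refine ⟨by omega, ?_, ?_, ?_⟩
    · intro i hi
      have := (p1 i hi).1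
      simp only [startOrigin] at this
      omega
    · intro i j hij
      have := (p2 i j hij).1
      simp only [rowOrigin] at this
      omega
    · intro i hi
      have := p3 i hi
      omega
  obtain ⟨s1, s2, s3⟩ := stepsOf_spec _ _ _ hw
  set st := stepsOf 0 0 (List.ofFn fun i => (f i).1 - s) with hst
  have hnorth : st.count Step.north = m + n := by
    rw [← length_areaWordFrom 0, s1, List.length_ofFn]
  have heast : st.count Step.east = m + n := by
    simp only [height] at s2
    omega
  let P : SquarePath (m + n) := ⟨st, hnorth, heast, fun d hd => by
    rw [s3] at hd
    exact (Option.mem_some_iff.1 hd).symm⟩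
  have ha : ∀ i, P.a i = (f i).1 - s := by
    intro i
    simp only [SquarePath.a, P]
    simp only [s1]
    simp
  have hshift : P.shift = s := by
    refine P.shift_eq s (fun i => ?_) ?_
    · rw [ha]
      have := h0 i
      omega
    · obtain ⟨i, hi, -⟩ := hbase
      exact ⟨i, by rw [ha, hi, zero_sub]⟩
  let L : LabelledSquarePath (m + n) :=
    { toSquarePath := P
      label := fun i => (f i).2.1
      label_lt := fun i j hij hlt => by
        have hfl := p2 i j hij
        simp only [Follows, rowOrigin] at hfl
        rw [ha, ha] at hlt
        exact hfl.2.1 (by omega)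
      label_first := fun i hi hz => by
        have hfl := p1 i hi
        simp only [Follows, startOrigin] at hfl
        rw [ha] at hz
        exact hfl.2.1 (by omega)
      label_base := fun _ => by
        obtain ⟨i, hi, hpos⟩ := hbase
        exact ⟨i, by rw [ha, hshift, hi, zero_sub], hpos⟩ }
  let π : ValleyDecoratedPath m n k :=
    { toLabelledSquarePath := L
      dv := Finset.univ.filter fun i => (f i).2.2 = true
      dv_valley := fun j hj => by
        have hj := (Finset.mem_filter.1 hj).2
        have haj : L.a j = (f j).1 - s := ha j
        rcases Nat.eq_zero_or_pos (j : ℕ) with h0 | h0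
        · left
          refine ⟨h0, ?_⟩
          have hfl := (p1 j h0).2.2 hj
          simp only [startOrigin] at hfl
          rw [haj]
          have : L.label j = (f j).2.1 := rfl
          omega
        · right
          let i : Fin (m + n) := ⟨j - 1, by omega⟩
          have hij : (j : ℕ) = (i : ℕ) + 1 := by simp only [i]; omega
          refine ⟨i, hij, ?_⟩
          have hfl := (p2 i j hij).2.2 hj
          simp only [rowOrigin] at hfl
          have hai : L.a i = (f i).1 - s := ha i
          rw [haj, hai]
          have h1 : L.label j = (f j).2.1 := rfl
          have h2 : L.label i = (f i).2.1 := rfl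
          omega
      card_positive := hn
      card_dv := hk }
  refine ⟨π, hshift, ?_⟩
  funext i
  refine Prod.ext ?_ (Prod.ext rfl ?_)
  · have h1 : π.a i = (f i).1 - s := ha i
    have h2 : π.shift = s := hshift
    simp only [row]
    omega
  · simp [row, π]

theorem dinv_eq (π : ValleyDecoratedPath m n k) :
    π.dinv = (inversions π.rowList : ℤ) + bonus π.shift π.rows - k := by
  rw [dinv, π.card_dv, rowList, inversions_ofFn, bonus, rows, Multiset.countP_map]
  congr 2
  · congr 2
    ext p
    simp only [Finset.mem_filter, Finset.mem_univ, true_and]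
    simp only [IsInversion, Attacks, row, decide_eq_false_iff_not, add_left_inj]
    have : π.a p.1 + (π.shift : ℤ) = π.a p.2 + π.shift + 1 ↔ π.a p.1 = π.a p.2 + 1 := by omega
    rw [this]
    tauto
  · rw [Finset.card_def, Finset.filter_val]
    congr 2
    refine Multiset.filter_congr fun i _ => ?_
    simp only [row]
    omega

theorem area_eq (π : ValleyDecoratedPath m n k) :
    π.area = (π.rows.map fun y => y.1).sum := by
  rw [area, rows, Multiset.map_map]
  rfl

theorem monomial_eq (π : ValleyDecoratedPath m n k) :
    π.monomial = (π.rows.map fun y =>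
      if y.2.1 = 0 then (1 : MvPolynomial ℕ QT) else MvPolynomial.X y.2.1).prod := by
  rw [monomial, rows, Multiset.map_map]
  rfl

theorem diagonal_eq (π : ValleyDecoratedPath m n k) (i : ℕ) :
    π.diagonal i = diagonalOf π.rows i := by
  rw [diagonal, diagonalOf, rows, Multiset.filter_map, Multiset.map_map, Finset.filter_val]
  congr 2
  refine Multiset.filter_congr fun j _ => ?_
  simp only [Function.comp, row]
  omega

theorem top_eq (π : ValleyDecoratedPath m n k) :
    π.top = (π.rows.map fun y => y.1.toNat).sup := by
  rw [rows, Multiset.map_map]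
  rfl

theorem diagonalWord_eq (π : ValleyDecoratedPath m n k) :
    π.diagonalWord
      = (List.range ((π.rows.map fun y => y.1.toNat).sup + 1)).reverse.flatMap
          (diagonalOf π.rows) := by
  rw [diagonalWord, ← top_eq, funext π.diagonal_eq]

theorem level_nonneg (π : ValleyDecoratedPath m n k) {y : Row} (hy : y ∈ π.rows) : 0 ≤ y.1 := by
  obtain ⟨j, -, rfl⟩ := Multiset.mem_map.1 hy
  have := π.toSquarePath.neg_shift_le_a j
  simp only [row]
  omega

theorem level_le_top (π : ValleyDecoratedPath m n k) (j : Fin (m + n)) :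
    π.a j + π.shift ≤ π.top := by
  have : (π.a j + (π.shift : ℤ)).toNat ≤ π.top :=
    Finset.le_sup (f := fun j => (π.a j + (π.shift : ℤ)).toNat) (Finset.mem_univ j)
  omega

theorem exists_level_eq_top (π : ValleyDecoratedPath m n k) (h : 0 < m + n) :
    ∃ j, π.a j + π.shift = π.top := by
  obtain ⟨j, -, hj⟩ := Finset.exists_mem_eq_sup (Finset.univ : Finset (Fin (m + n)))
    ⟨⟨0, h⟩, Finset.mem_univ _⟩ fun j => (π.a j + (π.shift : ℤ)).toNat
  have := π.toSquarePath.neg_shift_le_a j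
  refine ⟨j, ?_⟩
  have hj : π.top = (π.a j + (π.shift : ℤ)).toNat := hj
  omega

/-- Levels rise by at most one per row, so crossing from `b` to above it uses consecutive rows on
`b` and `b + 1`, whose labels increase. -/
theorem exists_ascent_of_le (π : ValleyDecoratedPath m n k) (h : 0 < m + n) (b : ℤ)
    (i j : Fin (m + n)) (hij : i ≤ j) (hi : π.a i ≤ b) (hj : b < π.a j) :
    ∃ i j, π.a i = b ∧ π.a j = b + 1 ∧ π.label i < π.label j := by
  obtain ⟨-, -, a2, -⟩ := (isAreaWord_ofFn _ _ _).1 (π.isAreaWord_a h)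
  by_contra hno
  have key : ∀ d : ℕ, ∀ l : Fin (m + n), (l : ℕ) = i + d → π.a l ≤ b := by
    intro d
    induction d with
    | zero =>
      intro l hl
      obtain rfl : l = i := Fin.ext (by omega)
      exact hi
    | succ d ih =>
      intro l hl
      let l' : Fin (m + n) := ⟨i + d, by omega⟩
      have h1 := ih l' rfl
      have hl' : (l : ℕ) = l' + 1 := by simp only [l']; omega
      have h2 := a2 l' l hl'
      by_contra h3
      exact hno ⟨l', l, by omega, by omega, π.label_lt l' l hl' (by omega)⟩
  have := key (j - i) j (by have : (i : ℕ) ≤ j := hij; omega)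
  omega

theorem exists_ascent (π : ValleyDecoratedPath m n k) (h : 0 < m + n) (b : ℕ) (hb : b < π.top) :
    ∃ i j, π.a i + π.shift = b ∧ π.a j + π.shift = b + 1 ∧ π.label i < π.label j := by
  obtain ⟨-, a1, -, a3⟩ := (isAreaWord_ofFn _ _ _).1 (π.isAreaWord_a h)
  -- Below the main diagonal the path climbs from a lowest row to its last row, which is on or above
  -- that diagonal; otherwise it climbs from its first row to a highest one.
  have : ∃ i j : Fin (m + n), i ≤ j ∧ π.a i ≤ b - π.shift ∧ (b : ℤ) - π.shift < π.a j := by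
    rcases lt_or_ge b π.shift with hbs | hbs
    · obtain ⟨i, hi, -⟩ := π.label_base h
      refine ⟨i, ⟨m + n - 1, by omega⟩, ?_, ?_, ?_⟩
      · rw [Fin.le_def]
        simp only
        omega
      · omega
      · have := a3 ⟨m + n - 1, by omega⟩ (by simp only; omega)
        omega
    · obtain ⟨j, hj⟩ := π.exists_level_eq_top h
      refine ⟨⟨0, h⟩, j, ?_, ?_, ?_⟩
      · rw [Fin.le_def]
        exact Nat.zero_le _
      · have := a1 ⟨0, h⟩ rfl
        omega
      · omega
  obtain ⟨i, j, hij, h1, h2⟩ := this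
  obtain ⟨i, j, e1, e2, e3⟩ := π.exists_ascent_of_le h _ i j hij h1 h2
  exact ⟨i, j, by omega, by omega, e3⟩

theorem letter_mem_diagonal (π : ValleyDecoratedPath m n k) {b : ℕ} {j : Fin (m + n)}
    (hj : π.a j + π.shift = b) : π.letter j ∈ π.diagonal b := by
  simp only [diagonal, Multiset.mem_sort, Multiset.mem_map, Finset.mem_val, Finset.mem_filter,
    Finset.mem_univ, true_and]
  exact ⟨j, by omega, rfl⟩

theorem diagonal_pairwise (π : ValleyDecoratedPath m n k) (b : ℕ) :
    (π.diagonal b).Pairwise (· ≤ ·) :=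
  Multiset.pairwise_sort _ _

theorem fst_le_fst {x y : MarkedLetter} (h : x ≤ y) :
    (ofLex x).1 ≤ (ofLex y).1 :=
  Prod.Lex.monotone_fst _ _ h

theorem diagonal_ne_nil (π : ValleyDecoratedPath m n k) (h : 0 < m + n) {b : ℕ} (hb : b ≤ π.top) :
    π.diagonal b ≠ [] := by
  rcases Nat.lt_or_eq_of_le hb with hb | rfl
  · obtain ⟨i, -, hi, -⟩ := π.exists_ascent h b hb
    exact List.ne_nil_of_mem (π.letter_mem_diagonal hi)
  · obtain ⟨i, hi⟩ := π.exists_level_eq_top h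
    exact List.ne_nil_of_mem (π.letter_mem_diagonal hi)

/-- An ascent between consecutive diagonals makes both nonempty and forces a strict descent at their
junction, so no run straddles two diagonals. -/
theorem splitBy_diagonalWord (π : ValleyDecoratedPath m n k) (h : 0 < m + n) :
    π.diagonalWord.splitBy (fun x y => decide ((ofLex x).1 ≤ (ofLex y).1))
      = (List.range (π.top + 1)).reverse.map π.diagonal := by
  rw [diagonalWord, List.flatMap_def]
  refine List.splitBy_flatten ?_ ?_ ?_
  · intro hmem
    obtain ⟨b, hb, hb0⟩ := List.mem_map.1 hmem
    rw [List.mem_reverse, List.mem_range] at hb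
    exact π.diagonal_ne_nil h (by omega) hb0
  · intro w hw
    obtain ⟨b, -, rfl⟩ := List.mem_map.1 hw
    refine (π.diagonal_pairwise b).isChain.imp fun x y hxy => ?_
    simpa using fst_le_fst hxy
  · rw [List.isChain_map, List.isChain_reverse, List.isChain_range]
    intro b hb
    have hb : b < π.top := by omega
    refine ⟨π.diagonal_ne_nil h (Nat.succ_le_of_lt hb), π.diagonal_ne_nil h hb.le, ?_⟩
    obtain ⟨i, j, hi, hj, hlt⟩ := π.exists_ascent h b hb
    have h1 := fst_le_fst ((π.diagonal_pairwise (b + 1)).rel_getLast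
      (π.letter_mem_diagonal (b := b + 1) (by push_cast; exact hj)))
    have h2 := fst_le_fst ((π.diagonal_pairwise b).rel_head (π.letter_mem_diagonal hi))
    have h3 : (ofLex (π.letter i)).1 = π.label i := rfl
    have h4 : (ofLex (π.letter j)).1 = π.label j := rfl
    rw [decide_eq_false_iff_not, not_le]
    refine lt_of_le_of_lt (h2.trans_eq h3) (lt_of_lt_of_le hlt (h4.symm.trans_le h1))

theorem diagonal_eq_nil (π : ValleyDecoratedPath m n k) {b : ℕ} (hb : π.top < b) :
    π.diagonal b = [] := by
  refine List.eq_nil_iff_forall_not_mem.2 fun x hx => ?_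
  simp only [diagonal, Multiset.mem_sort, Multiset.mem_map, Finset.mem_val, Finset.mem_filter,
    Finset.mem_univ, true_and] at hx
  obtain ⟨j, hj, -⟩ := hx
  have := π.level_le_top j
  omega

theorem run_diagonalWord (π : ValleyDecoratedPath m n k) (h : 0 < m + n) (i : ℕ) :
    π.diagonalWord.run i = π.diagonal i := by
  rw [MarkedWord.run, if_neg (by omega), splitBy_diagonalWord π h, List.map_reverse,
    List.reverse_reverse, Int.toNat_natCast, List.getD_eq_getElem?_getD, List.getElem?_map]
  rcases Nat.lt_or_ge π.top i with hi | hi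
  · rw [List.getElem?_eq_none (by simp; omega), π.diagonal_eq_nil hi]
    rfl
  · rw [List.getElem?_range (by omega)]
    rfl

theorem count_rows (π : ValleyDecoratedPath m n k) (i c : ℕ) (d : Bool) :
    π.rows.count ((i : ℤ), c, d) = (π.diagonal i).count (toLex (c, d)) := by
  have hcount : ∀ (l : MarkedWord) (x : MarkedLetter),
      l.count x = (l : Multiset MarkedLetter).countP (· = x) := by
    intro l x
    rw [Multiset.coe_countP, List.count]
    exact List.countP_congr fun y _ => by simp
  rw [diagonal_eq, diagonalOf, hcount, Multiset.sort_eq, Multiset.countP_map,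
    Multiset.filter_filter, Multiset.count, Multiset.countP_eq_card_filter]
  congr 1
  refine Multiset.filter_congr fun y _ => ?_
  obtain ⟨j, e, f⟩ := y
  simp only [Prod.mk.injEq, toLex_inj]
  constructor
  · rintro ⟨rfl, rfl, rfl⟩; exact ⟨⟨rfl, rfl⟩, rfl⟩
  · rintro ⟨⟨rfl, rfl⟩, rfl⟩; exact ⟨rfl, rfl, rfl⟩

/-- The runs recover the diagonals, and these give the multiplicity of every row. -/
theorem diagonalWord_eq_iff (h : 0 < m + n) (π π' : ValleyDecoratedPath m n k) :
    π.diagonalWord = π'.diagonalWord ↔ π.rows = π'.rows := by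
  constructor
  · intro hw
    ext ⟨i, c, d⟩
    rcases lt_or_ge i 0 with hi | hi
    · rw [Multiset.count_eq_zero_of_notMem, Multiset.count_eq_zero_of_notMem]
      · exact fun hy => absurd (π'.level_nonneg hy) (by simpa using hi)
      · exact fun hy => absurd (π.level_nonneg hy) (by simpa using hi)
    · lift i to ℕ using hi
      rw [count_rows, count_rows, ← run_diagonalWord π h, ← run_diagonalWord π' h, hw]
  · intro hr
    rw [diagonalWord_eq, diagonalWord_eq, hr]

theorem multDec_diagonalWord (π : ValleyDecoratedPath m n k) (h : 0 < m + n) (i : ℤ) :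
    π.diagonalWord.multDec i 0 = π.rows.count (i, 0, true) := by
  rcases lt_or_ge i 0 with hi | hi
  · rw [MarkedWord.multDec, MarkedWord.run, if_pos hi, Multiset.count_eq_zero_of_notMem]
    · rfl
    · exact fun hy => absurd (π.level_nonneg hy) (by simpa using hi)
  · lift i to ℕ using hi
    rw [MarkedWord.multDec, run_diagonalWord π h, count_rows]

theorem length_runPos_diagonalWord (π : ValleyDecoratedPath m n k) (h : 0 < m + n) (i : ℤ) :
    (π.diagonalWord.runPos i).length = numPos π.rows i := by
  rcases lt_or_ge i 0 with hi | hi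
  · rw [MarkedWord.runPos, MarkedWord.run, if_pos hi, numPos]
    symm
    rw [List.filter_nil, List.length_nil, Multiset.countP_eq_zero]
    intro y hy hy'
    have := π.level_nonneg hy
    omega
  · lift i to ℕ using hi
    rw [MarkedWord.runPos, run_diagonalWord π h, ← List.countP_eq_length_filter, numPos,
      diagonal_eq, diagonalOf]
    have e := Multiset.coe_countP (fun x : MarkedLetter => (ofLex x).2 = false ∧ (ofLex x).1 ≠ 0)
      (((π.rows.filter fun y : Row => y.1 = (i : ℤ)).map
        fun y : Row => (toLex (y.2.1, y.2.2) : MarkedLetter)).sort (· ≤ ·))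
    rw [← e, Multiset.sort_eq, Multiset.countP_map, Multiset.filter_filter,
      Multiset.countP_eq_card_filter]
    congr 1
    refine Multiset.filter_congr fun y _ => ?_
    simp only [ofLex_toLex]
    rw [Nat.pos_iff_ne_zero]
    tauto

end ValleyDecoratedPath

/-! ### Specialization to `ℚ(q,t)` and the final identity -/

theorem qVar_pow_ne_one {j : ℕ} (hj : j ≠ 0) : qVar ^ j ≠ 1 := by
  intro h
  rw [qVar, ← map_pow, ← map_one (algebraMap (MvPolynomial (Fin 2) ℚ) QT)] at h
  have h := IsFractionRing.injective (MvPolynomial (Fin 2) ℚ) QT h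
  have h2 := congrArg (MvPolynomial.eval fun _ => (2 : ℚ)) h
  simp only [map_pow, MvPolynomial.eval_X, map_one] at h2
  exact (one_lt_pow₀ (by norm_num : (1 : ℚ) < 2) hj).ne' h2

theorem qVar_ne_one : qVar ≠ 1 := by
  simpa using qVar_pow_ne_one one_ne_zero

theorem qVar_ne_zero : qVar ≠ 0 := by
  rw [qVar, Ne, map_eq_zero_iff _ (IsFractionRing.injective (MvPolynomial (Fin 2) ℚ) QT)]
  exact MvPolynomial.X_ne_zero 0

theorem qNat_qVar_ne_zero (j : ℕ) : qNat qVar (j + 1) ≠ 0 := by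
  rw [← qNat_eq_div qVar_ne_one, zpow_natCast]
  exact div_ne_zero (sub_ne_zero.2 (qVar_pow_ne_one (Nat.succ_ne_zero j)).symm)
    (sub_ne_zero.2 qVar_ne_one.symm)

theorem qInt_ne_zero {j : ℤ} (hj : j ≠ 0) : qInt j ≠ 0 := by
  refine div_ne_zero (sub_ne_zero.2 fun h => ?_) (sub_ne_zero.2 qVar_ne_one.symm)
  rcases Int.natAbs_eq j with e | e
  · rw [e, zpow_natCast] at h
    exact qVar_pow_ne_one (Int.natAbs_ne_zero.2 hj) h.symm
  · rw [e, zpow_neg, zpow_natCast, eq_comm, inv_eq_one] at h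
    exact qVar_pow_ne_one (Int.natAbs_ne_zero.2 hj) h

/-- `π₀` only provides the multiset of rows; its own shift is unrelated to `s`, so the same `π₀`
serves both shifts of the theorem. -/
theorem LSQ_eq_pathSum {m n k : ℕ} (h : 0 < m + n) (π₀ : ValleyDecoratedPath m n k) (s : ℕ) :
    LSQ m n k π₀.diagonalWord s
      = MvPolynomial.C (qVar ^ (-(k : ℤ)) * tVar ^ π₀.area *
          (qVar ^ bonus s π₀.rows * pathSum qVar s (startOrigin s) π₀.rows)) * π₀.monomial := by
  have key : ∑ π ∈ (ValleyDecoratedPath.finite_setOf m n k π₀.diagonalWord s).toFinset,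
      qVar ^ inversions π.rowList = pathSum qVar s (startOrigin s) π₀.rows := by
    rw [pathSum]
    refine Finset.sum_bij (fun π _ => π.rowList) ?_ ?_ ?_ (fun _ _ => rfl)
    · intro π hπ
      obtain ⟨h1, h2⟩ := (Set.Finite.mem_toFinset _).1 hπ
      rw [ValleyDecoratedPath.diagonalWord_eq_iff h] at h2
      rw [Finset.mem_filter, mem_orderings, π.coe_rowList, h2, ← h1]
      exact ⟨rfl, π.isPathFrom_rowList h⟩
    · intro π hπ π' hπ' hl
      obtain ⟨h1, -⟩ := (Set.Finite.mem_toFinset _).1 hπ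
      obtain ⟨h1', -⟩ := (Set.Finite.mem_toFinset _).1 hπ'
      exact ValleyDecoratedPath.rowList_injective h (h1.trans h1'.symm) hl
    · intro l hl
      obtain ⟨hl, hp⟩ := Finset.mem_filter.1 hl
      rw [mem_orderings] at hl
      have hlen : l.length = m + n := by
        have := congrArg Multiset.card hl
        simpa [ValleyDecoratedPath.rows] using this.symm
      obtain ⟨f, rfl⟩ : ∃ f : Fin (m + n) → Row, l = List.ofFn f := by
        refine ⟨fun i => l[(i : ℕ)]'(by omega), ?_⟩
        refine List.ext_getElem (by simpa using hlen) fun i h1 h2 => by simp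
      have hf : π₀.rows = (Finset.univ : Finset (Fin (m + n))).val.map f := by
        rw [hl, Fin.univ_val_map]
      have hcard : ∀ (P : Row → Prop) [DecidablePred P],
          (Finset.univ.filter fun i => P (f i)).card
            = (Finset.univ.filter fun i => P (π₀.row i)).card := by
        intro P _
        have e1 : π₀.rows.countP P = (Finset.univ.filter fun i => P (π₀.row i)).card := by
          rw [ValleyDecoratedPath.rows, Multiset.countP_map]; rfl
        have e2 : π₀.rows.countP P = (Finset.univ.filter fun i => P (f i)).card := by
          rw [hf, Multiset.countP_map]; rfl
        rw [← e1, ← e2]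
      -- All remaining conditions depend on the multiset alone, in particular the positive label on
      -- the lowest diagonal, so they carry over from `π₀`.
      obtain ⟨π, hs, hrow⟩ := ValleyDecoratedPath.exists_rowList_eq (k := k) h s f hp
        (fun i => π₀.level_nonneg (by rw [hf]; exact Multiset.mem_map_of_mem f (Finset.mem_univ i)))
        (by
          obtain ⟨i, hi, hpos⟩ := π₀.label_base h
          have hmem : π₀.row i ∈ π₀.rows := Multiset.mem_map_of_mem _ (Finset.mem_univ i)
          rw [hf] at hmem
          obtain ⟨j, -, hj⟩ := Multiset.mem_map.1 hmem
          refine ⟨j, ?_, ?_⟩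
          · rw [hj]
            simp only [ValleyDecoratedPath.row]
            omega
          · rw [hj]
            exact hpos)
        (by
          rw [hcard fun y => 0 < y.2.1]
          exact π₀.card_positive)
        (by
          rw [hcard fun y => y.2.2 = true]
          simp [ValleyDecoratedPath.row, π₀.card_dv])
      refine ⟨π, ?_, ?_⟩
      · rw [Set.Finite.mem_toFinset]
        refine ⟨hs, ?_⟩
        rw [ValleyDecoratedPath.diagonalWord_eq_iff h, hf, ValleyDecoratedPath.rows, hrow]
      · rw [ValleyDecoratedPath.rowList, hrow]
  rw [← key, LSQ, Finset.mul_sum, Finset.mul_sum, map_sum, Finset.sum_mul]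
  refine Finset.sum_congr rfl fun π hπ => ?_
  obtain ⟨h1, h2⟩ := (Set.Finite.mem_toFinset _).1 hπ
  rw [ValleyDecoratedPath.diagonalWord_eq_iff h] at h2
  rw [π.monomial_eq, π₀.monomial_eq, π.area_eq, π₀.area_eq, π.dinv_eq, h2, h1,
    sub_eq_add_neg, zpow_add₀ qVar_ne_zero, zpow_add₀ qVar_ne_zero, zpow_natCast, zpow_natCast]
  congr 2
  ring

theorem run_nil (i : ℤ) : MarkedWord.run [] i = [] := by
  rw [MarkedWord.run]
  split_ifs
  · rfl
  · simp

theorem ValleyDecoratedPath.diagonalWord_eq_nil {m n k : ℕ} (h : m + n = 0)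
    (π : ValleyDecoratedPath m n k) : π.diagonalWord = [] := by
  refine List.eq_nil_iff_forall_not_mem.2 fun x hx => ?_
  simp only [diagonalWord, List.mem_flatMap, diagonal, Multiset.mem_sort, Multiset.mem_map,
    Finset.mem_val, Finset.mem_filter] at hx
  obtain ⟨_, _, j, -⟩ := hx
  have := j.isLt
  omega

theorem mainTheorem2 (m n k : ℕ) (z : MarkedWord)
    (hz : ∃ π : ValleyDecoratedPath m n k, π.diagonalWord = z) (s : ℕ) (hs : 1 ≤ s)
    (num den : ℤ)
    (hnum : num = ((z.runPos s).length : ℤ) - (z.multDec ((s : ℤ) - 1) 0 : ℤ))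
    (hden : den = ((z.runPos ((s : ℤ) - 1)).length : ℤ) - (z.multDec ((s : ℤ) - 2) 0 : ℤ)) :
    (den ≠ 0 →
      LSQ m n k z s
        = MvPolynomial.C (qVar ^ den * (qInt num / qInt den)) * LSQ m n k z (s - 1)) ∧
    MvPolynomial.C (qInt den) * LSQ m n k z s
      = MvPolynomial.C (qVar ^ den * qInt num) * LSQ m n k z (s - 1) := by
  have cleared : MvPolynomial.C (qInt den) * LSQ m n k z s
      = MvPolynomial.C (qVar ^ den * qInt num) * LSQ m n k z (s - 1) := by
    obtain ⟨π, rfl⟩ := hz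
    rcases Nat.eq_zero_or_pos (m + n) with h | h
    -- For the empty path both `q`-integers are `[0] = 0`, so the cleared identity is trivial.
    · rw [π.diagonalWord_eq_nil h] at hnum hden
      have h1 : num = 0 := by rw [hnum]; simp [MarkedWord.runPos, MarkedWord.multDec, run_nil]
      have h2 : den = 0 := by rw [hden]; simp [MarkedWord.runPos, MarkedWord.multDec, run_nil]
      simp [h1, h2, qInt]
    · rw [π.length_runPos_diagonalWord h, π.multDec_diagonalWord h] at hnum hden
      have hr := pathSum_ratio qNat_qVar_ne_zero qVar_ne_zero qVar_ne_one s π.rows num den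
        hnum hden
      rw [LSQ_eq_pathSum h, LSQ_eq_pathSum h, ← mul_assoc (MvPolynomial.C (qInt den)),
        ← mul_assoc (MvPolynomial.C (qVar ^ den * qInt num)), ← map_mul, ← map_mul,
        Nat.cast_sub hs, Nat.cast_one]
      congr 2
      simp only [qInt]
      linear_combination (qVar ^ (-(k : ℤ)) * tVar ^ π.area) * hr
  refine ⟨fun h => ?_, cleared⟩
  have hne := qInt_ne_zero h
  have h1 : LSQ m n k z s = MvPolynomial.C (qInt den)⁻¹ *
      (MvPolynomial.C (qInt den) * LSQ m n k z s) := by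
    rw [← mul_assoc, ← map_mul, inv_mul_cancel₀ hne, map_one, one_mul]
  rw [h1, cleared, ← mul_assoc, ← map_mul]
  congr 2
  rw [div_eq_mul_inv]
  ring
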